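/- For finite groups $G,H$ let $\mathbb{F}_2B(G)=\mathbb{F}_2\otimes_{\mathbb Z}B(G)$, where $B(G)$ is the Burnside group of finite $G$-sets, and let $\mathbb{F}_2B(H,G)=\mathbb{F}_2B(H\times G^{op})$ be the corresponding group for finite $(H,G)$-bisets. Each $\alpha\in\mathbb{F}_2B(H,G)$ induces a linear map $\mathbb{F}_2B(\alpha):\mathbb{F}_2B(G)\to\mathbb{F}_2B(H)$, obtained by extending $([U],[X])\mapsto[U\times_GX]$ bilinearly. A subfunctor $M$ of the biset functor $\mathbb{F}_2B$ is a family of subspaces $M(G)\subseteq\mathbb{F}_2B(G)$, for all finite groups $G$, with $\mathbb{F}_2B(\alpha)(M(G))\subseteq M(H)$ for all $G,H$ and all $\alpha\in\mathbb{F}_2B(H,G)$. For a set $\mathcal G$ of pairs $(R,v)$ with $R$ a finite group and $v\in\mathbb{F}_2B(R)$, let $\langle\mathcal G\rangle$ be the subfunctor generated by $\mathcal G$, i.e. the intersection of all subfunctors $M$ such that $v\in M(R)$ for all $(R,v)\in\mathcal G$. Let $\mathcal S$ be a set of finite groups consisting of exactly one group of order $p$ for each odd prime $p$, exactly one cyclic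 group of order $4$, and exactly one semidihedral group $SD_{2^n}$ of order $2^n$ for each $n\ge4$. For $R\in\mathcal S$ let $\overline{\varepsilon}_R\in\mathbb{F}_2B(R)$ be the class of - $R/\mathbf 1-R/R$ if $R$ has odd prime order, - $R/\mathbf 1-R/T$ if $R$ is cyclic of order $4$, where $T$ is the subgroup of order $2$ of $R$, - $R/I-R/IZ$ if $R$ is semidihedral, where $I$ is a non-central subgroup of order $2$ of $R$ and $Z$ is the center of $R$. For $\mathcal S'\subseteq\mathcal S$ let $\mathcal G_{\mathcal S'}=\{(R,\overline{\varepsilon}_R)\mid R\in\mathcal S'\}$, and let $L=\langle\mathcal G_{\mathcal S}\rangle$. Then $\mathcal G_{\mathcal S}$ is a minimal generating set of $L$: it generates $L$, and no proper subset of it does. Moreover, for every proper subset $\mathcal S'\subsetneq\mathcal S$, the subfunctor $\langle\mathcal G_{\mathcal S'}\rangle$ is a proper subfunctor of $L$. -/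

import Mathlib

noncomputable section

namespace BisetTheory

/-! ### Finite `G`-sets -/

/-- A finite (left) `G`-set. -/
structure FinGSet (G : Type) [Group G] : Type 1 where
  carrier : Type
  [action : MulAction G carrier]
  [finite : Finite carrier]

attribute [instance] FinGSet.action FinGSet.finite

namespace FinGSet

variable {G : Type} [Group G]

/-- Isomorphism of `G`-sets. -/
def Iso (X Y : FinGSet G) : Prop :=
  ∃ e : X.carrier ≃ Y.carrier, ∀ (g : G) (x : X.carrier), e (g • x) = g • e x

/-- Disjoint union of `G`-sets. -/
def disjUnion (X Y : FinGSet G) : FinGSet G where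
  carrier := X.carrier ⊕ Y.carrier

/-- The transitive `G`-set `G/H`. -/
def coset (G : Type) [Group G] [Finite G] (H : Subgroup G) : FinGSet G where
  carrier := G ⧸ H

end FinGSet

/-! ### Burnside groups -/

/-- The defining relations of the Burnside group: isomorphic `G`-sets have the same class, and
`[X ⊔ Y] = [X] + [Y]`. -/
def burnsideRel (k : Type) [CommRing k] (G : Type) [Group G] : Set (FinGSet G →₀ k) :=
  {v | ∃ X Y : FinGSet G, X.Iso Y ∧ v = Finsupp.single X 1 - Finsupp.single Y 1} ∪
  {v | ∃ X Y : FinGSet G,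
    v = Finsupp.single (X.disjUnion Y) 1 - Finsupp.single X 1 - Finsupp.single Y 1}

/-- `kB(G) = k ⊗ B(G)`: the `k`-module generated by the finite `G`-sets, subject to the relations
`burnsideRel`. For `k = ℤ` this is the (additive group of the) Burnside ring `B(G)`. -/
abbrev Burnside (k : Type) [CommRing k] (G : Type) [Group G] : Type 1 :=
  (FinGSet G →₀ k) ⧸ Submodule.span k (burnsideRel k G)

namespace Burnside

variable (k : Type) [CommRing k] {G : Type} [Group G]

/-- The class `[X]` of a finite `G`-set `X` in `kB(G)`. -/
def cls (X : FinGSet G) : Burnside k G :=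
  Submodule.Quotient.mk (Finsupp.single X 1)

variable {k}

theorem cls_eq_of_iso {X Y : FinGSet G} (h : X.Iso Y) : cls k X = cls k Y := by
  refine (Submodule.Quotient.eq _).2 (Submodule.subset_span (Or.inl ⟨X, Y, h, rfl⟩))

theorem cls_disjUnion (X Y : FinGSet G) : cls k (X.disjUnion Y) = cls k X + cls k Y := by
  refine (Submodule.Quotient.eq (p := Submodule.span k (burnsideRel k G))
    (y := Finsupp.single X 1 + Finsupp.single Y 1)).2 (Submodule.subset_span (Or.inr ⟨X, Y, ?_⟩))
  rw [sub_sub]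

/-- A map on finite `G`-sets that is invariant under isomorphism and additive on disjoint unions
extends linearly to `kB(G)`. -/
def lift {M : Type 1} [AddCommGroup M] [Module k M] (f : FinGSet G → M)
    (hiso : ∀ X Y : FinGSet G, X.Iso Y → f X = f Y)
    (hadd : ∀ X Y : FinGSet G, f (X.disjUnion Y) = f X + f Y) : Burnside k G →ₗ[k] M :=
  Submodule.liftQ _ (Finsupp.linearCombination k f) (by
    rw [Submodule.span_le]
    rintro v (⟨X, Y, h, rfl⟩ | ⟨X, Y, rfl⟩)
    · simp [hiso X Y h]
    · simp [hadd X Y])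

@[simp]
theorem lift_cls {M : Type 1} [AddCommGroup M] [Module k M] (f : FinGSet G → M)
    (hiso : ∀ X Y : FinGSet G, X.Iso Y → f X = f Y)
    (hadd : ∀ X Y : FinGSet G, f (X.disjUnion Y) = f X + f Y) (X : FinGSet G) :
    lift (k := k) f hiso hadd (cls k X) = f X := by
  simp [lift, cls]

theorem hom_ext {M : Type 1} [AddCommGroup M] [Module k M] {f g : Burnside k G →ₗ[k] M}
    (h : ∀ X : FinGSet G, f (cls k X) = g (cls k X)) : f = g := by
  refine Submodule.linearMap_qext _ (Finsupp.lhom_ext' fun X => LinearMap.ext_ring ?_)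
  exact h X

end Burnside

/-! ### Bisets and their action on Burnside groups -/

/-- A finite `(H, G)`-biset, that is, a finite `H × Gᵒᵖ`-set. -/
abbrev FinBiset (H G : Type) [Group H] [Group G] : Type 1 := FinGSet (H × Gᵐᵒᵖ)

namespace FinBiset

variable {H G : Type} [Group H] [Group G]

/-- The left action `h · u`. -/
def lact (U : FinBiset H G) (h : H) (u : U.carrier) : U.carrier :=
  ((h, 1) : H × Gᵐᵒᵖ) • u

/-- The right action `u · g`. -/
def ract (U : FinBiset H G) (u : U.carrier) (g : G) : U.carrier :=
  ((1, MulOpposite.op g) : H × Gᵐᵒᵖ) • u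

theorem ract_one (U : FinBiset H G) (u : U.carrier) : U.ract u 1 = u :=
  one_smul (H × Gᵐᵒᵖ) u

theorem ract_mul (U : FinBiset H G) (u : U.carrier) (a b : G) :
    U.ract u (a * b) = U.ract (U.ract u a) b := by
  simp [ract, smul_smul]

theorem lact_ract (U : FinBiset H G) (h : H) (u : U.carrier) (g : G) :
    U.lact h (U.ract u g) = U.ract (U.lact h u) g := by
  simp [lact, ract, smul_smul]

/-- The orbit relation on `U × X` of the right action `(u, x) g = (u g, g⁻¹ x)` of `G`. -/
def tensorSetoid (U : FinBiset H G) (X : FinGSet G) : Setoid (U.carrier × X.carrier) where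
  r a b := ∃ g : G, b = (U.ract a.1 g, g⁻¹ • a.2)
  iseqv :=
    { refl := fun a => ⟨1, by simp [ract_one]⟩
      symm := by
        rintro a b ⟨g, rfl⟩
        exact ⟨g⁻¹, by simp [← ract_mul, ract_one]⟩
      trans := by
        rintro a b c ⟨g, rfl⟩ ⟨g', rfl⟩
        exact ⟨g * g', by simp [ract_mul, smul_smul]⟩ }

instance tensorAction (U : FinBiset H G) (X : FinGSet G) :
    MulAction H (Quotient (tensorSetoid U X)) where
  smul h := Quotient.map' (fun a => (U.lact h a.1, a.2)) (by
    rintro a b ⟨g, rfl⟩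
    exact ⟨g, by simp [lact_ract]⟩)
  one_smul := by
    rintro ⟨a⟩
    exact congrArg (Quotient.mk (tensorSetoid U X))
      (Prod.ext (one_smul (H × Gᵐᵒᵖ) a.1) rfl)
  mul_smul := by
    rintro h h' ⟨a⟩
    refine congrArg (Quotient.mk (tensorSetoid U X)) (Prod.ext ?_ rfl)
    simp [lact, smul_smul]

/-- The `H`-set `U ×_G X = (U × X)/G`, with `h · [u, x] = [h u, x]`. -/
def tensor (U : FinBiset H G) (X : FinGSet G) : FinGSet H where
  carrier := Quotient (tensorSetoid U X)

theorem tensor_iso_right (U : FinBiset H G) {X Y : FinGSet G} (h : X.Iso Y) :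
    (tensor U X).Iso (tensor U Y) := by
  obtain ⟨e, he⟩ := h
  refine ⟨Quotient.congr ((Equiv.refl _).prodCongr e) ?_, ?_⟩
  · rintro ⟨u, x⟩ ⟨v, y⟩
    refine exists_congr fun g => ?_
    simp [Prod.ext_iff, ← he]
  · rintro h ⟨a⟩
    rfl

theorem tensor_iso_left {U V : FinBiset H G} (h : U.Iso V) (X : FinGSet G) :
    (tensor U X).Iso (tensor V X) := by
  obtain ⟨e, he⟩ := h
  refine ⟨Quotient.congr (e.prodCongr (Equiv.refl _)) ?_, ?_⟩
  · rintro ⟨u, x⟩ ⟨v, y⟩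
    refine exists_congr fun g => ?_
    simp [Prod.ext_iff, ract, ← he]
  · rintro h ⟨a⟩
    exact congrArg (Quotient.mk (tensorSetoid V X)) (Prod.ext (he _ _) rfl)

theorem tensor_disjUnion_right (U : FinBiset H G) (X Y : FinGSet G) :
    (tensor U (X.disjUnion Y)).Iso ((tensor U X).disjUnion (tensor U Y)) := by
  refine ⟨⟨Quotient.lift (s := tensorSetoid U (X.disjUnion Y))
      (fun a => match a with
        | (u, Sum.inl x) => Sum.inl (Quotient.mk (tensorSetoid U X) (u, x))
        | (u, Sum.inr y) => Sum.inr (Quotient.mk (tensorSetoid U Y) (u, y))) ?_,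
      Sum.elim
        (Quotient.lift (s := tensorSetoid U X) (fun a =>
          Quotient.mk (tensorSetoid U (X.disjUnion Y)) (a.1, Sum.inl a.2)) ?_)
        (Quotient.lift (s := tensorSetoid U Y) (fun a =>
          Quotient.mk (tensorSetoid U (X.disjUnion Y)) (a.1, Sum.inr a.2)) ?_), ?_, ?_⟩, ?_⟩
  · rintro ⟨u, x | x⟩ _ ⟨g, rfl⟩
    · exact congrArg Sum.inl (Quotient.sound ⟨g, rfl⟩)
    · exact congrArg Sum.inr (Quotient.sound ⟨g, rfl⟩)
  · rintro a _ ⟨g, rfl⟩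
    exact Quotient.sound ⟨g, rfl⟩
  · rintro a _ ⟨g, rfl⟩
    exact Quotient.sound ⟨g, rfl⟩
  · rintro ⟨u, x | x⟩ <;> rfl
  · rintro (a | a) <;> exact Quotient.inductionOn a fun _ => rfl
  · rintro h ⟨u, x | x⟩ <;> rfl

theorem tensor_disjUnion_left (U V : FinBiset H G) (X : FinGSet G) :
    (tensor (FinGSet.disjUnion U V) X).Iso ((tensor U X).disjUnion (tensor V X)) := by
  refine ⟨⟨Quotient.lift (s := tensorSetoid (FinGSet.disjUnion U V) X)
      (fun a => match a with
        | (Sum.inl u, x) => Sum.inl (Quotient.mk (tensorSetoid U X) (u, x))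
        | (Sum.inr v, x) => Sum.inr (Quotient.mk (tensorSetoid V X) (v, x))) ?_,
      Sum.elim
        (Quotient.lift (s := tensorSetoid U X) (fun a =>
          Quotient.mk (tensorSetoid (FinGSet.disjUnion U V) X) (Sum.inl a.1, a.2)) ?_)
        (Quotient.lift (s := tensorSetoid V X) (fun a =>
          Quotient.mk (tensorSetoid (FinGSet.disjUnion U V) X) (Sum.inr a.1, a.2)) ?_), ?_, ?_⟩, ?_⟩
  · rintro ⟨u | u, x⟩ _ ⟨g, rfl⟩
    · exact congrArg Sum.inl (Quotient.sound ⟨g, rfl⟩)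
    · exact congrArg Sum.inr (Quotient.sound ⟨g, rfl⟩)
  · rintro a _ ⟨g, rfl⟩
    exact Quotient.sound ⟨g, rfl⟩
  · rintro a _ ⟨g, rfl⟩
    exact Quotient.sound ⟨g, rfl⟩
  · rintro ⟨u | u, x⟩ <;> rfl
  · rintro (a | a) <;> exact Quotient.inductionOn a fun _ => rfl
  · rintro h ⟨u | u, x⟩ <;> rfl

end FinBiset

/-- The action of `kB(H, G) = kB(H × Gᵒᵖ)` on `kB(G)`, with values in `kB(H)`: the bilinear map
with `([U], [X]) ↦ [U ×_G X]`. Thus `bisetMap α` is the value `kB(α) : kB(G) → kB(H)` of the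
Burnside biset functor `kB` at the morphism `α` from `G` to `H`. -/
def bisetMap {k : Type} [CommRing k] {H G : Type} [Group H] [Group G] :
    Burnside k (H × Gᵐᵒᵖ) →ₗ[k] Burnside k G →ₗ[k] Burnside k H :=
  Burnside.lift
    (fun U => Burnside.lift (fun X => Burnside.cls k (FinBiset.tensor U X))
      (fun _ _ h => Burnside.cls_eq_of_iso (FinBiset.tensor_iso_right U h))
      (fun X Y => (Burnside.cls_eq_of_iso (FinBiset.tensor_disjUnion_right U X Y)).trans
        (Burnside.cls_disjUnion _ _)))
    (fun _ _ h => Burnside.hom_ext fun X => by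
      simpa using Burnside.cls_eq_of_iso (FinBiset.tensor_iso_left h X))
    (fun U V => Burnside.hom_ext fun X => by
      simpa using (Burnside.cls_eq_of_iso (FinBiset.tensor_disjUnion_left U V X)).trans
        (Burnside.cls_disjUnion _ _))

theorem bisetMap_cls {k : Type} [CommRing k] {H G : Type} [Group H] [Group G]
    (U : FinBiset H G) (X : FinGSet G) :
    bisetMap (Burnside.cls k U) (Burnside.cls k X) = Burnside.cls k (FinBiset.tensor U X) := by
  simp [bisetMap]

/-! ### Subfunctors of the Burnside biset functor -/

/-- A biset subfunctor of `kB`: for each finite group `G` a submodule of `kB(G)`, stable under all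
the maps `kB(α) : kB(G) → kB(H)` for `α ∈ kB(H, G)`. -/
@[ext]
structure BurnsideSubfunctor (k : Type) [CommRing k] : Type 1 where
  obj : ∀ G : FiniteGrp.{0}, Submodule k (Burnside k G)
  map_mem : ∀ (G H : FiniteGrp.{0}) (α : Burnside k (H × (G : Type)ᵐᵒᵖ)),
    ∀ v ∈ obj G, bisetMap α v ∈ obj H

namespace BurnsideSubfunctor

variable {k : Type} [CommRing k]

/-- Subfunctors are ordered by inclusion. -/
instance : PartialOrder (BurnsideSubfunctor k) :=
  PartialOrder.lift obj fun _ _ h => BurnsideSubfunctor.ext h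

/-- An element of `kB`: a pair `(R, v)` of a finite group `R` and `v ∈ kB(R)`. -/
abbrev Element (k : Type) [CommRing k] : Type 1 := Σ R : FiniteGrp.{0}, Burnside k R

/-- The subfunctor `⟨𝒢⟩` generated by a set `𝒢` of elements: the intersection of all the
subfunctors `M` with `v ∈ M(R)` for all `(R, v) ∈ 𝒢`. -/
def generated (𝒢 : Set (Element k)) : BurnsideSubfunctor k where
  obj G := ⨅ M : {M : BurnsideSubfunctor k // ∀ x ∈ 𝒢, x.2 ∈ M.obj x.1}, M.1.obj G
  map_mem G H α v hv := by
    rw [Submodule.mem_iInf] at hv ⊢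
    exact fun M => M.1.map_mem G H α v (hv M)

/-- `𝒢` generates the subfunctor `M`, and no proper subset of `𝒢` does. -/
def IsMinimalGeneratingSet (𝒢 : Set (Element k)) (M : BurnsideSubfunctor k) : Prop :=
  generated 𝒢 = M ∧ ∀ 𝒢' : Set (Element k), 𝒢' ⊂ 𝒢 → generated 𝒢' ≠ M

end BurnsideSubfunctor

/-! ### The groups and the generators -/

/-- `R` is a semidihedral group of order `2 ^ n` (meant for `n ≥ 4`):
`R = ⟨a, b⟩` with `a` of order `2 ^ (n - 1)`, `b` of order `2` and
`b a b⁻¹ = a ^ (2 ^ (n - 2) - 1)`. -/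
def IsSemidihedral (n : ℕ) (R : Type) [Group R] : Prop :=
  Nat.card R = 2 ^ n ∧ ∃ a b : R, orderOf a = 2 ^ (n - 1) ∧ orderOf b = 2 ∧
    b * a * b⁻¹ = a ^ (2 ^ (n - 2) - 1) ∧ Subgroup.closure {a, b} = ⊤

/-- `S` consists of exactly one group of order `p` for each odd prime `p`, exactly one cyclic group
of order `4`, and exactly one semidihedral group of order `2 ^ n` for each `n ≥ 4`. -/
structure IsFamilyS (S : Set FiniteGrp.{0}) : Prop where
  mem_type : ∀ R ∈ S, ((Nat.card R).Prime ∧ Odd (Nat.card R)) ∨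
    (IsCyclic R ∧ Nat.card R = 4) ∨ ∃ n : ℕ, 4 ≤ n ∧ IsSemidihedral n R
  prime : ∀ p : ℕ, p.Prime → Odd p → ∃! R : FiniteGrp.{0}, R ∈ S ∧ Nat.card R = p
  four : ∃! R : FiniteGrp.{0}, R ∈ S ∧ IsCyclic R ∧ Nat.card R = 4
  semidihedral : ∀ n : ℕ, 4 ≤ n → ∃! R : FiniteGrp.{0}, R ∈ S ∧ IsSemidihedral n R

/-- The possible expressions of the element `ε_R` of `kB(R)`, for `R` of odd prime order, cyclic of
order `4`, or semidihedral of order at least `16`. The subgroup `T` below is the only one of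
order `2`, and the subgroups `I` below are all conjugate, so `ε_R` is unique. -/
inductive IsEpsilon (k : Type) [CommRing k] (R : Type) [Group R] [Finite R] :
    Burnside k R → Prop
  | prime (hp : (Nat.card R).Prime) (hodd : Odd (Nat.card R)) :
      IsEpsilon k R (Burnside.cls k (FinGSet.coset R ⊥) - Burnside.cls k (FinGSet.coset R ⊤))
  | four (hc : IsCyclic R) (h4 : Nat.card R = 4) (T : Subgroup R) (hT : Nat.card T = 2) :
      IsEpsilon k R (Burnside.cls k (FinGSet.coset R ⊥) - Burnside.cls k (FinGSet.coset R T))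
  | semidihedral (n : ℕ) (hn : 4 ≤ n) (hR : IsSemidihedral n R)
      (I : Subgroup R) (hI : Nat.card I = 2) (hIZ : ¬ I ≤ Subgroup.center R) :
      IsEpsilon k R (Burnside.cls k (FinGSet.coset R I) -
        Burnside.cls k (FinGSet.coset R (I ⊔ Subgroup.center R)))

open Classical in
/-- The element `ε_R ∈ kB(R)` (and `0` for the groups `R` not listed in `IsEpsilon`). For
`k = 𝔽₂` it is the reduction modulo `2` of the element `ε_R` of `B(R)`. -/
def epsilon (k : Type) [CommRing k] (R : Type) [Group R] [Finite R] : Burnside k R :=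
  if h : ∃ v, IsEpsilon k R v then h.choose else 0

/-- `𝒢_S = {(R, ε̄_R) | R ∈ S}`, a set of elements of `𝔽₂B`. -/
def generators (S : Set FiniteGrp.{0}) : Set (BurnsideSubfunctor.Element (ZMod 2)) :=
  {x | ∃ R ∈ S, x = ⟨R, epsilon (ZMod 2) R⟩}

/-- The subfunctor `L` of `𝔽₂B`: the one generated by `𝒢_S`. -/
def subfunctorL (S : Set FiniteGrp.{0}) : BurnsideSubfunctor (ZMod 2) :=
  BurnsideSubfunctor.generated (generators S)

end BisetTheory

end

/-!
Let `A` be a cyclic `p`-subgroup of `R` whose socle `⟨z⟩` is central in `R`. The points of an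
`R`-set moved by `z` form its free `A`-orbits, and the parity of the number of these orbits is a
linear form on `𝔽₂B(R)`. For suitable `A` it is nonzero at `ε_R`, as `R/H⟨z⟩` has no free `A`-orbit
and `R/H` is a single one when `ε_R = R/H - R/H⟨z⟩`. If `|R'| ≠ |R|`, it vanishes at
`U ×_{R'} ε_{R'}`: there the number of points moved by `z` is determined by the numbers of fixed
points on `U` of the pairs formed from powers of `z` and of its analogue `z'` in `R'`, and bounds on
stabilizers in `R × R'` show that it is divisible by `2|A|`. Hence `ε_R` does not lie in the
subfunctor generated by the other `ε_{R'}`.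
-/

namespace BisetTheory

section Tensor

namespace FinBiset

variable {K H G : Type} [Group K] [Group H] [Group G] {X : FinGSet G}

/-- The element `[u, x]` of `U ×_G X`. -/
def tmul (U : FinBiset H G) (u : U.carrier) (x : X.carrier) : (tensor U X).carrier :=
  Quotient.mk (tensorSetoid U X) (u, x)

theorem tmul_eq_tmul_iff {U : FinBiset H G} {u v : U.carrier} {x y : X.carrier} :
    U.tmul u x = U.tmul v y ↔ ∃ g : G, v = U.ract u g ∧ y = g⁻¹ • x :=
  Quotient.eq.trans (exists_congr fun _ => Prod.mk_inj)

theorem tmul_ract (U : FinBiset H G) (u : U.carrier) (g : G) (x : X.carrier) :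
    U.tmul (U.ract u g) x = U.tmul u (g • x) :=
  (tmul_eq_tmul_iff.2 ⟨g, rfl, (inv_smul_smul g x).symm⟩).symm

theorem smul_tmul (U : FinBiset H G) (h : H) (u : U.carrier) (x : X.carrier) :
    h • U.tmul u x = U.tmul (U.lact h u) x :=
  rfl

theorem exists_tmul_eq {U : FinBiset H G} (a : (tensor U X).carrier) :
    ∃ u x, U.tmul u x = a := by
  obtain ⟨⟨u, x⟩, rfl⟩ := Quotient.exists_rep a
  exact ⟨u, x, rfl⟩

/-- The map out of `U ×_G X` induced by a `G`-balanced map out of `U × X`. -/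
def tensorLift {U : FinBiset H G} {α : Type*} (f : U.carrier → X.carrier → α)
    (hf : ∀ u g x, f (U.ract u g) x = f u (g • x)) : (tensor U X).carrier → α :=
  Quotient.lift (s := tensorSetoid U X) (fun a => f a.1 a.2) (by
    rintro ⟨u, x⟩ _ ⟨g, rfl⟩
    rw [hf, smul_inv_smul])

@[simp]
theorem tensorLift_tmul {U : FinBiset H G} {α : Type*} (f : U.carrier → X.carrier → α)
    (hf : ∀ u g x, f (U.ract u g) x = f u (g • x)) (u : U.carrier) (x : X.carrier) :
    tensorLift f hf (U.tmul u x) = f u x :=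
  rfl

theorem lact_one (U : FinBiset H G) (u : U.carrier) : U.lact 1 u = u :=
  one_smul (H × Gᵐᵒᵖ) u

theorem lact_mul (U : FinBiset H G) (h h' : H) (u : U.carrier) :
    U.lact (h * h') u = U.lact h (U.lact h' u) := by
  simp [lact, smul_smul]

/-- The left `H`-set underlying an `(H, G)`-biset. -/
def leftSet (U : FinBiset H G) : FinGSet H where
  carrier := U.carrier
  action := MulAction.compHom U.carrier (MonoidHom.inl H Gᵐᵒᵖ)

instance compAction (V : FinBiset K H) (U : FinBiset H G) :
    MulAction (K × Gᵐᵒᵖ) (tensor V U.leftSet).carrier where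
  smul p := tensorLift
    (fun v (u : U.carrier) => V.tmul (X := U.leftSet) (V.lact p.1 v) (U.ract u p.2.unop))
    fun v h (u : U.carrier) => calc
      V.tmul (X := U.leftSet) (V.lact p.1 (V.ract v h)) (U.ract u p.2.unop)
        = V.tmul (X := U.leftSet) (V.ract (V.lact p.1 v) h) (U.ract u p.2.unop) := by
          rw [lact_ract]
      _ = V.tmul (X := U.leftSet) (V.lact p.1 v) (U.lact h (U.ract u p.2.unop)) :=
          tmul_ract (X := U.leftSet) V (V.lact p.1 v) h (U.ract u p.2.unop)
      _ = V.tmul (X := U.leftSet) (V.lact p.1 v) (U.ract (U.lact h u) p.2.unop) := by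
          rw [lact_ract]
  one_smul a := by
    obtain ⟨v, u, rfl⟩ := exists_tmul_eq a
    exact congrArg₂ (V.tmul (X := U.leftSet)) (lact_one V v) (ract_one U u)
  mul_smul p q a := by
    obtain ⟨v, u, rfl⟩ := exists_tmul_eq a
    exact congrArg₂ (V.tmul (X := U.leftSet)) (lact_mul V p.1 q.1 v) (ract_mul U u _ _)

/-- The composite `V ×_H U` of bisets, a `(K, G)`-biset. -/
def comp (V : FinBiset K H) (U : FinBiset H G) : FinBiset K G where
  carrier := (tensor V U.leftSet).carrier

/-- The element `[v, u]` of `V ×_H U`. -/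
def compMk (V : FinBiset K H) (U : FinBiset H G) (v : V.carrier) (u : U.carrier) :
    (comp V U).carrier :=
  V.tmul (X := U.leftSet) v u

theorem compMk_ract (V : FinBiset K H) (U : FinBiset H G) (v : V.carrier) (h : H)
    (u : U.carrier) : compMk V U (V.ract v h) u = compMk V U v (U.lact h u) :=
  tmul_ract (X := U.leftSet) V v h u

theorem lact_compMk (V : FinBiset K H) (U : FinBiset H G) (k : K) (v : V.carrier)
    (u : U.carrier) : (comp V U).lact k (compMk V U v u) = compMk V U (V.lact k v) u :=
  congrArg (compMk V U (V.lact k v)) (ract_one U u)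

theorem ract_compMk (V : FinBiset K H) (U : FinBiset H G) (v : V.carrier) (u : U.carrier)
    (g : G) : (comp V U).ract (compMk V U v u) g = compMk V U v (U.ract u g) :=
  congrArg (compMk V U · (U.ract u g)) (lact_one V v)

/-- The map `[v, [u, x]] ↦ [[v, u], x]`. -/
def tensorAssoc (V : FinBiset K H) (U : FinBiset H G) (X : FinGSet G) :
    (tensor V (tensor U X)).carrier → (tensor (comp V U) X).carrier :=
  tensorLift
    (fun v => tensorLift (fun u x => (comp V U).tmul (compMk V U v u) x) fun u g x => by
      rw [← ract_compMk, tmul_ract])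
    fun v h a => by
      obtain ⟨u, x, rfl⟩ := exists_tmul_eq a
      simp only [smul_tmul, tensorLift_tmul, compMk_ract]

/-- The map `[[v, u], x] ↦ [v, [u, x]]`. -/
def tensorAssocInv (V : FinBiset K H) (U : FinBiset H G) (X : FinGSet G) :
    (tensor (comp V U) X).carrier → (tensor V (tensor U X)).carrier :=
  tensorLift
    (fun a x => tensorLift (X := U.leftSet) (fun v u => V.tmul v (U.tmul u x))
      (fun v h u => tmul_ract V v h (U.tmul u x)) a)
    fun a g x => by
      obtain ⟨v, u, rfl⟩ := exists_tmul_eq (X := U.leftSet) a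
      exact (congrArg (tensorLift _ _) (ract_compMk V U v u g)).trans
        (congrArg (V.tmul v) (tmul_ract U u g x))

theorem tensor_comp (V : FinBiset K H) (U : FinBiset H G) (X : FinGSet G) :
    (tensor V (tensor U X)).Iso (tensor (comp V U) X) := by
  refine ⟨⟨tensorAssoc V U X, tensorAssocInv V U X, fun a => ?_, fun a => ?_⟩, fun k a => ?_⟩
  · obtain ⟨v, b, rfl⟩ := exists_tmul_eq a
    obtain ⟨u, x, rfl⟩ := exists_tmul_eq b
    rfl
  · obtain ⟨c, x, rfl⟩ := exists_tmul_eq a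
    obtain ⟨v, u, rfl⟩ := exists_tmul_eq (X := U.leftSet) c
    rfl
  · obtain ⟨v, b, rfl⟩ := exists_tmul_eq a
    obtain ⟨u, x, rfl⟩ := exists_tmul_eq b
    exact congrArg ((comp V U).tmul · x) (lact_compMk V U k v u).symm

/-- The identity biset `G`, with `G` acting by left and right multiplication. -/
def identity (G : Type) [Group G] [Finite G] : FinBiset G G where
  carrier := G
  action :=
    { smul := fun p u => p.1 * u * p.2.unop
      one_smul := fun u => by change 1 * u * 1 = u; simp
      mul_smul := fun p q u => by
        change (p.1 * q.1) * u * (q.2.unop * p.2.unop) = p.1 * (q.1 * u * q.2.unop) * p.2.unop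
        group }

section Identity

variable [Finite G]

theorem lact_identity (g u : G) : (identity G).lact g u = g * u :=
  mul_one (g * u)

theorem ract_identity (u g : G) : (identity G).ract u g = u * g :=
  congrArg (· * g) (one_mul u)

theorem tensor_identity (X : FinGSet G) : (tensor (identity G) X).Iso X := by
  let act (u : G) (x : X.carrier) : X.carrier := u • x
  refine ⟨⟨tensorLift (U := identity G) act fun u g x => ?_,
    fun x => (identity G).tmul (1 : G) x, fun a => ?_, fun x => one_smul G x⟩, fun g a => ?_⟩
  · exact (congrArg (act · x) (ract_identity (G := G) u g)).trans (mul_smul (α := G) u g x)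
  · obtain ⟨u, x, rfl⟩ := exists_tmul_eq a
    exact (tmul_ract (identity G) (1 : G) u x).symm.trans
      (congrArg ((identity G).tmul · x) ((ract_identity (1 : G) u).trans (one_mul (M := G) u)))
  · obtain ⟨u, x, rfl⟩ := exists_tmul_eq a
    exact (congrArg (act · x) (lact_identity (G := G) g u)).trans (mul_smul (α := G) g u x)

end Identity

end FinBiset

theorem bisetMap_comp {k : Type} [CommRing k] {K H G : Type} [Group K] [Group H] [Group G]
    (V : FinBiset K H) (U : FinBiset H G) (v : Burnside k G) :
    bisetMap (Burnside.cls k V) (bisetMap (Burnside.cls k U) v) =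
      bisetMap (Burnside.cls k (V.comp U)) v := by
  suffices h : (bisetMap (Burnside.cls k V)).comp (bisetMap (Burnside.cls k U)) =
      bisetMap (Burnside.cls k (V.comp U)) from LinearMap.congr_fun h v
  refine Burnside.hom_ext fun X => ?_
  simp only [LinearMap.comp_apply, bisetMap_cls]
  exact Burnside.cls_eq_of_iso (FinBiset.tensor_comp V U X)

theorem bisetMap_identity {k : Type} [CommRing k] {G : Type} [Group G] [Finite G]
    (v : Burnside k G) : bisetMap (Burnside.cls k (FinBiset.identity G)) v = v := by
  suffices h : bisetMap (Burnside.cls k (FinBiset.identity G)) = LinearMap.id from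
    LinearMap.congr_fun h v
  refine Burnside.hom_ext fun X => ?_
  rw [bisetMap_cls]
  exact Burnside.cls_eq_of_iso (FinBiset.tensor_identity X)

end Tensor

namespace BurnsideSubfunctor

variable {k : Type} [CommRing k]

/-- The largest subfunctor of `kB` whose value at `R` is contained in `N`. -/
noncomputable def maximalWithin {R : Type} [Group R] (N : Submodule k (Burnside k R)) :
    BurnsideSubfunctor k where
  obj G := ⨅ U : FinBiset R G, N.comap (bisetMap (Burnside.cls k U))
  map_mem G H α v hv := by
    simp only [Submodule.mem_iInf, Submodule.mem_comap] at hv ⊢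
    intro V
    suffices h : N.mkQ ∘ₗ bisetMap (Burnside.cls k V) ∘ₗ bisetMap.flip v = 0 from
      (Submodule.Quotient.mk_eq_zero N).1 (LinearMap.congr_fun h α)
    refine Burnside.hom_ext fun U => (Submodule.Quotient.mk_eq_zero N).2 ?_
    exact (bisetMap_comp V U v).symm ▸ hv (V.comp U)

theorem mem_maximalWithin {R : Type} [Group R] {N : Submodule k (Burnside k R)}
    {G : FiniteGrp.{0}} {v : Burnside k G} :
    v ∈ (maximalWithin N).obj G ↔ ∀ U : FinBiset R G, bisetMap (Burnside.cls k U) v ∈ N := by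
  simp only [maximalWithin, Submodule.mem_iInf, Submodule.mem_comap]

theorem maximalWithin_obj_le {R : FiniteGrp.{0}} (N : Submodule k (Burnside k R)) :
    (maximalWithin N).obj R ≤ N := fun v hv => by
  simpa only [bisetMap_identity] using mem_maximalWithin.1 hv (FinBiset.identity R)

theorem mem_generated {𝒢 : Set (Element k)} {x : Element k} (hx : x ∈ 𝒢) :
    x.2 ∈ (generated 𝒢).obj x.1 := by
  simp only [generated, Submodule.mem_iInf]
  exact fun M => M.2 x hx

theorem generated_le {𝒢 : Set (Element k)} {M : BurnsideSubfunctor k}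
    (h : ∀ x ∈ 𝒢, x.2 ∈ M.obj x.1) : generated 𝒢 ≤ M :=
  fun _ => iInf_le_of_le ⟨M, h⟩ le_rfl

theorem generated_mono {𝒢 𝒢' : Set (Element k)} (h : 𝒢' ⊆ 𝒢) : generated 𝒢' ≤ generated 𝒢 :=
  generated_le fun _ hx => mem_generated (h hx)

theorem generated_lt_of_ssubset {𝒢 𝒢' : Set (Element k)}
    (h : ∀ x ∈ 𝒢, x.2 ∉ (generated (𝒢 \ {x})).obj x.1) (h' : 𝒢' ⊂ 𝒢) :
    generated 𝒢' < generated 𝒢 := by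
  obtain ⟨x, hx, hx'⟩ := Set.exists_of_ssubset h'
  refine (generated_mono h'.subset).lt_of_not_ge fun hle => h x hx ?_
  exact generated_mono (Set.subset_sdiff_singleton h'.subset hx') x.1 (hle x.1 (mem_generated hx))

end BurnsideSubfunctor

section FixedPoints

open MulAction

variable {Γ : Type*} [Group Γ]

theorem dvd_ncard_of_dvd_relIndex_stabilizer {Ω : Type*} [MulAction Γ Ω] [Finite Ω]
    {A : Subgroup Γ} {s : Set Ω} (hs : ∀ x ∈ A, ∀ u ∈ s, x • u ∈ s) {d : ℕ}
    (hd : ∀ u ∈ s, d ∣ (stabilizer Γ u).relIndex A) : d ∣ s.ncard := by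
  let p : SubMulAction A Ω := ⟨s, fun x {u} hu => hs x x.2 u hu⟩
  have := Fintype.ofFinite (orbitRel.Quotient A p)
  change d ∣ Nat.card p
  rw [Nat.card_congr (selfEquivSigmaOrbits A p), Nat.card_sigma]
  refine Finset.dvd_sum fun ω _ => ?_
  rw [Nat.card_coe_set_eq, ← index_stabilizer, SubMulAction.stabilizer_of_subMul]
  exact hd _ ω.out.2

theorem card_dvd_ncard_of_inf_stabilizer_eq_bot {Ω : Type*} [MulAction Γ Ω] [Finite Ω]
    {A : Subgroup Γ} {s : Set Ω} (hs : ∀ x ∈ A, ∀ u ∈ s, x • u ∈ s)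
    (hfree : ∀ u ∈ s, A ⊓ stabilizer Γ u = ⊥) : Nat.card A ∣ s.ncard :=
  dvd_ncard_of_dvd_relIndex_stabilizer hs fun u hu => by
    rw [← Subgroup.inf_relIndex_left, hfree u hu, Subgroup.relIndex_bot_left]

section OrbitCounting

variable {K Ω : Type*} [Group K] [MulAction K Ω]

theorem card_smul_eq {u v : Ω} (h : v ∈ orbit K u) :
    Nat.card {k : K // k • v = u} = Nat.card (stabilizer K u) := by
  obtain ⟨g, rfl⟩ := h
  exact Nat.card_congr
    ((Equiv.mulRight g).subtypeEquiv fun k => by simp [mul_smul, mem_stabilizer_iff])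

theorem sum_card_stabilizer_eq_card {s : Finset Ω} {u : Ω}
    (hs : (s : Set Ω) = orbit K u) : ∑ v ∈ s, Nat.card (stabilizer K v) = Nat.card K := by
  have hcard (v : Ω) (hv : v ∈ s) : s.card * Nat.card (stabilizer K v) = Nat.card K := by
    have horb : (s : Set Ω) = orbit K v :=
      hs.trans (orbit_eq_iff.2 (hs ▸ Finset.mem_coe.2 hv)).symm
    rw [← Set.ncard_coe_finset, horb, ← index_stabilizer, mul_comm, Subgroup.card_mul_index]
  have hu : u ∈ s := Finset.mem_coe.1 (hs ▸ mem_orbit_self u)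
  rw [Finset.sum_const_nat fun v hv => Nat.eq_of_mul_eq_mul_left
    (Finset.card_pos.2 ⟨u, hu⟩) ((hcard v hv).trans (hcard u hu).symm), hcard u hu]

/-- A form of Burnside's orbit-counting lemma: `p` exhibits `Q` as the set of `K`-orbits on `Ω`. -/
theorem card_mul_ncard_fixed_eq_sum [Fintype K] [Finite Ω] {Q : Type*} {p : Ω → Q}
    (hp : p.Surjective) (horbit : ∀ u v, p u = p v ↔ u ∈ orbit K v) {t : Ω → Ω} {σ : Q → Q}
    (h : Function.Semiconj p t σ) :
    Nat.card K * {q | σ q = q}.ncard = ∑ k : K, {u | k • t u = u}.ncard := by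
  classical
  have := Fintype.ofFinite Ω
  have := Fintype.ofSurjective p hp
  have hstab (u : Ω) : (Finset.univ.filter fun k : K => k • t u = u).card =
      if σ (p u) = p u then Nat.card (stabilizer K u) else 0 := by
    split_ifs with hu
    · rw [← Fintype.card_subtype, ← Nat.card_eq_fintype_card]
      exact card_smul_eq ((horbit _ _).1 ((h u).trans hu))
    · rw [Finset.card_eq_zero, Finset.filter_eq_empty_iff]
      exact fun k _ hk => hu ((h u).symm.trans ((horbit _ _).2 (mem_orbit_symm.1 ⟨k, hk⟩)))
  have hfiber (q : Q) : (∑ u with p u = q, if σ (p u) = p u then Nat.card (stabilizer K u) else 0)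
      = if σ q = q then Nat.card K else 0 := by
    obtain ⟨u, rfl⟩ := hp q
    calc (∑ v with p v = p u, if σ (p v) = p v then Nat.card (stabilizer K v) else 0)
        = ∑ v with p v = p u, if σ (p u) = p u then Nat.card (stabilizer K v) else 0 :=
          Finset.sum_congr rfl fun v hv => by rw [(Finset.mem_filter.1 hv).2]
      _ = if σ (p u) = p u then Nat.card K else 0 := by
          rw [Finset.sum_ite_irrel, Finset.sum_const_zero, sum_card_stabilizer_eq_card (u := u)]
          ext v
          simp [horbit]
  calc Nat.card K * {q | σ q = q}.ncard
      = ∑ q : Q, if σ q = q then Nat.card K else 0 := by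
        rw [Set.ncard_eq_toFinset_card', ← Finset.sum_filter, Finset.sum_const,
          smul_eq_mul, mul_comm, Set.toFinset_ofPred]
    _ = ∑ u : Ω, (Finset.univ.filter fun k : K => k • t u = u).card := by
        simp only [hstab, ← Finset.sum_fiberwise Finset.univ p, hfiber]
    _ = ∑ k : K, (Finset.univ.filter fun u : Ω => k • t u = u).card :=
        (Finset.sum_card_bipartiteAbove_eq_sum_card_bipartiteBelow _).symm
    _ = ∑ k : K, {u | k • t u = u}.ncard := by
        simp_rw [Set.ncard_eq_toFinset_card', Set.toFinset_ofPred]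

end OrbitCounting

theorem ncard_fixedBy_mul_add {Ω : Type*} [MulAction Γ Ω] [Finite Ω] (x y : Γ) :
    Nat.card Ω + (fixedBy Ω (x * y)).ncard =
      (fixedBy Ω x).ncard + (fixedBy Ω y).ncard + ((fixedBy Ω x)ᶜ ∩ (fixedBy Ω y)ᶜ).ncard +
        ((fixedBy Ω x)ᶜ ∩ (fixedBy Ω y)ᶜ ∩ fixedBy Ω (x * y)).ncard := by
  have hinter : fixedBy Ω (x * y) \ ((fixedBy Ω x)ᶜ ∩ (fixedBy Ω y)ᶜ) =
      fixedBy Ω x ∩ fixedBy Ω y := by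
    ext u
    simp only [← Set.compl_union, Set.mem_sdiff, Set.mem_compl_iff, not_not, Set.mem_union,
      Set.mem_inter_iff, mem_fixedBy, mul_smul]
    constructor
    · rintro ⟨hxy, hx | hy⟩
      · exact ⟨hx, smul_left_cancel x (hxy.trans hx.symm)⟩
      · exact ⟨(congrArg (x • ·) hy).symm.trans hxy, hy⟩
    · rintro ⟨hx, hy⟩
      exact ⟨by rw [hy, hx], Or.inl hx⟩
  have h₁ := Set.ncard_union_add_ncard_inter (fixedBy Ω x) (fixedBy Ω y)
  have h₂ := Set.ncard_add_ncard_compl (fixedBy Ω x ∪ fixedBy Ω y)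
  have h₃ := Set.ncard_inter_add_ncard_sdiff_eq_ncard (fixedBy Ω (x * y))
    ((fixedBy Ω x)ᶜ ∩ (fixedBy Ω y)ᶜ)
  rw [hinter, Set.inter_comm] at h₃
  rw [Set.compl_union] at h₂
  lia

theorem ncard_fixedBy_eq_of_isConj {Γ Ω : Type*} [Group Γ] [MulAction Γ Ω] {x y : Γ}
    (h : IsConj x y) : (fixedBy Ω x).ncard = (fixedBy Ω y).ncard := by
  obtain ⟨g, rfl⟩ := isConj_iff.1 h
  rw [← smul_fixedBy, Set.ncard_smul_set]

theorem smul_mem_fixedBy_iff {Γ Ω : Type*} [Group Γ] [MulAction Γ Ω] {w : Γ}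
    (hw : w ∈ Subgroup.center Γ) (γ : Γ) {u : Ω} : γ • u ∈ fixedBy Ω w ↔ u ∈ fixedBy Ω w := by
  rw [mem_fixedBy, mem_fixedBy, smul_smul, ← Subgroup.mem_center_iff.1 hw γ, mul_smul,
    smul_left_cancel_iff]

theorem mk_mem_center {P Q : Type*} [Group P] [Group Q] {x : P} {y : Q}
    (hx : x ∈ Subgroup.center P) (hy : y ∈ Subgroup.center Q) :
    (x, y) ∈ Subgroup.center (P × Q) := by
  rw [Subgroup.center_prod]
  exact ⟨hx, hy⟩

/-- The number of fixed points of `(1, y)` minus the number of fixed points of `(x, y)`. -/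
noncomputable def fixDiff {P Q : Type*} [Group P] [Group Q] (Ω : Type*) [MulAction (P × Q) Ω]
    (x : P) (y : Q) : ℤ :=
  (fixedBy Ω ((1, y) : P × Q)).ncard - (fixedBy Ω (x, y)).ncard

/-- The points moved by both `(x, 1)` and `(1, y)`. -/
def movedByBoth {P Q : Type*} [Group P] [Group Q] (Ω : Type*) [MulAction (P × Q) Ω]
    (x : P) (y : Q) : Set Ω :=
  (fixedBy Ω ((x, 1) : P × Q))ᶜ ∩ (fixedBy Ω ((1, y) : P × Q))ᶜ

section

variable {P Q : Type*} [Group P] [Group Q] {Ω : Type*} [MulAction (P × Q) Ω]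

theorem mem_movedByBoth {x : P} {y : Q} {u : Ω} : u ∈ movedByBoth Ω x y ↔
    (x, (1 : Q)) ∉ stabilizer (P × Q) u ∧ ((1 : P), y) ∉ stabilizer (P × Q) u :=
  Iff.rfl

theorem smul_mem_movedByBoth {x : P} {y : Q} (hx : x ∈ Subgroup.center P)
    (hy : y ∈ Subgroup.center Q) (γ : P × Q) {u : Ω} (hu : u ∈ movedByBoth Ω x y) :
    γ • u ∈ movedByBoth Ω x y :=
  ⟨mt (smul_mem_fixedBy_iff (mk_mem_center hx (one_mem _)) γ).1 hu.1,
    mt (smul_mem_fixedBy_iff (mk_mem_center (one_mem _) hy) γ).1 hu.2⟩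

theorem fixDiff_one_sub_fixDiff [Finite Ω] (x : P) (y : Q) :
    fixDiff Ω x (1 : Q) - fixDiff Ω x y =
      (movedByBoth Ω x y).ncard + (movedByBoth Ω x y ∩ fixedBy Ω (x, y)).ncard := by
  have h := ncard_fixedBy_mul_add (Ω := Ω) ((x, 1) : P × Q) (1, y)
  have h1 : (fixedBy Ω ((1 : P), (1 : Q))).ncard = Nat.card Ω := by
    rw [Prod.mk_one_one, fixedBy_one_eq_univ, Set.ncard_univ]
  rw [Prod.mk_mul_mk, one_mul, mul_one] at h
  simp only [fixDiff, movedByBoth, h1]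
  lia

theorem fixDiff_eq_of_isConj (x : P) {y y' : Q} (h : IsConj y y') :
    fixDiff Ω x y = fixDiff Ω x y' := by
  have hconj (w : P) : IsConj (w, y) (w, y') := by
    obtain ⟨g, rfl⟩ := isConj_iff.1 h
    exact isConj_iff.2 ⟨(1, g), by simp⟩
  rw [fixDiff, fixDiff, ncard_fixedBy_eq_of_isConj (hconj 1), ncard_fixedBy_eq_of_isConj (hconj x)]

end

namespace FinGSet

variable {R : Type} [Group R] [Finite R] (H : Subgroup R)

/-- The coset `gH` as a point of the `R`-set `R/H`. -/
def cosetMk (g : R) : (coset R H).carrier :=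
  (g : R ⧸ H)

theorem cosetMk_surjective : Function.Surjective (cosetMk H) :=
  QuotientGroup.mk_surjective

theorem cosetMk_eq_iff {g g' : R} : cosetMk H g = cosetMk H g' ↔ g⁻¹ * g' ∈ H :=
  QuotientGroup.eq

theorem smul_cosetMk (x g : R) : x • cosetMk H g = cosetMk H (x * g) :=
  rfl

end FinGSet

/-- The number of points of `X` moved by `z`. -/
noncomputable def movedCard {R : Type} [Group R] (z : R) (X : FinGSet R) : ℕ :=
  (fixedBy X.carrier z)ᶜ.ncard

section

variable {R : Type} [Group R] (z : R)

theorem movedCard_eq_of_iso {X Y : FinGSet R} (h : X.Iso Y) : movedCard z X = movedCard z Y := by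
  obtain ⟨e, he⟩ := h
  have : (fixedBy X.carrier z)ᶜ = e ⁻¹' (fixedBy Y.carrier z)ᶜ := by
    ext x
    simp [← he]
  rw [movedCard, this, Set.ncard_preimage_of_injective_subset_range e.injective (by simp),
    movedCard]

theorem movedCard_disjUnion (X Y : FinGSet R) :
    movedCard z (X.disjUnion Y) = movedCard z X + movedCard z Y := by
  have h : Sum.inl '' (fixedBy X.carrier z)ᶜ ∪ Sum.inr '' (fixedBy Y.carrier z)ᶜ =
      (fixedBy (X.disjUnion Y).carrier z)ᶜ := by
    ext (x | y)
    · refine Iff.trans ?_ (not_congr (Sum.inl_injective.eq_iff (a := z • x))).symm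
      simp
    · refine Iff.trans ?_ (not_congr (Sum.inr_injective.eq_iff (a := z • y))).symm
      simp
  rw [movedCard, ← h]
  refine (Set.ncard_union_eq ?_).trans
    (congrArg₂ (· + ·) (Set.ncard_image_of_injective _ Sum.inl_injective)
      (Set.ncard_image_of_injective _ Sum.inr_injective))
  exact Set.isCompl_range_inl_range_inr.disjoint.mono
    (Set.image_subset_range _ _) (Set.image_subset_range _ _)

variable {z} [Finite R] {H : Subgroup R}

theorem smul_coset_eq_self_iff (hz : z ∈ Subgroup.center R) (x : (FinGSet.coset R H).carrier) :
    z • x = x ↔ z ∈ H := by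
  obtain ⟨g, rfl⟩ := FinGSet.cosetMk_surjective H x
  rw [FinGSet.smul_cosetMk, eq_comm, FinGSet.cosetMk_eq_iff, ← Subgroup.mem_center_iff.1 hz g,
    inv_mul_cancel_left]

theorem movedCard_coset_of_mem (hz : z ∈ Subgroup.center R) (h : z ∈ H) :
    movedCard z (FinGSet.coset R H) = 0 := by
  rw [movedCard, Set.ncard_eq_zero, Set.compl_empty_iff, Set.eq_univ_iff_forall]
  exact fun x => (smul_coset_eq_self_iff hz x).2 h

theorem movedCard_coset_of_notMem (hz : z ∈ Subgroup.center R) (h : z ∉ H) :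
    movedCard z (FinGSet.coset R H) = H.index := by
  have hempty : fixedBy (FinGSet.coset R H).carrier z = ∅ :=
    Set.eq_empty_iff_forall_notMem.2 fun x hx => h ((smul_coset_eq_self_iff hz x).1 hx)
  rw [movedCard, hempty, Set.compl_empty, Set.ncard_univ, FinGSet.coset, Subgroup.index]

end

namespace FinBiset

variable {P Q : Type} [Group P] [Group Q]

/-- The `(P, Q)`-biset `U` as a left `P × Q`-set, with `(x, y) • u = x u y⁻¹`. -/
def toProd (U : FinBiset P Q) : FinGSet (P × Q) where
  carrier := U.carrier
  action := MulAction.compHom U.carrier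
    ((MonoidHom.id P).prodMap (MulEquiv.inv' Q).toMonoidHom)

theorem toProd_smul (U : FinBiset P Q) (x : P) (y : Q) (u : U.toProd.carrier) :
    (x, y) • u = U.ract (U.lact x u) y⁻¹ := by
  refine Eq.trans ?_ (mul_smul (β := U.carrier) (1, MulOpposite.op y⁻¹) (x, 1) u)
  exact congrArg (SMul.smul (α := U.carrier) · u) (by simp : (x, MulOpposite.op y⁻¹) = _)

section Coset

variable [Finite Q] (U : FinBiset P Q) (H : Subgroup Q)

theorem tmul_cosetMk (u : U.carrier) (g : Q) :
    U.tmul u (FinGSet.cosetMk H g) = U.tmul (U.ract u g) (FinGSet.cosetMk H 1) := by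
  rw [tmul_ract, FinGSet.smul_cosetMk, mul_one]

theorem tmul_cosetMk_one_eq_iff {u v : U.carrier} :
    U.tmul u (FinGSet.cosetMk H 1) = U.tmul v (FinGSet.cosetMk H 1) ↔ ∃ h ∈ H, v = U.ract u h := by
  simp only [tmul_eq_tmul_iff, FinGSet.smul_cosetMk, FinGSet.cosetMk_eq_iff, mul_one, inv_one,
    one_mul, inv_mem_iff, and_comm]

theorem card_mul_ncard_fixedBy_tensor_coset [Fintype H] (x : P) :
    Nat.card H * (fixedBy (U.tensor (FinGSet.coset Q H)).carrier x).ncard =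
      ∑ h : H, (fixedBy U.toProd.carrier (x, (h : Q))).ncard := by
  let : MulAction H U.toProd.carrier :=
    MulAction.compHom _ ((MonoidHom.inr P Q).comp H.subtype)
  have hsmul (h : H) (u : U.toProd.carrier) : h • u = U.ract u (h : Q)⁻¹ := rfl
  let p (u : U.toProd.carrier) := U.tmul u (FinGSet.cosetMk H 1)
  have hp : p.Surjective := fun a => by
    obtain ⟨u, c, rfl⟩ := exists_tmul_eq a
    obtain ⟨g, rfl⟩ := FinGSet.cosetMk_surjective H c
    exact ⟨U.ract u g, (U.tmul_cosetMk H u g).symm⟩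
  have horbit (u v) : p u = p v ↔ u ∈ orbit H v := by
    refine eq_comm.trans ((U.tmul_cosetMk_one_eq_iff H).trans ⟨?_, ?_⟩)
    · rintro ⟨h, hh, hv⟩
      exact ⟨⟨h, hh⟩⁻¹, (hsmul _ v).trans ((congrArg (U.ract v) (inv_inv h)).trans hv.symm)⟩
    · rintro ⟨h, hv⟩
      exact ⟨(h : Q)⁻¹, inv_mem h.2, hv.symm⟩
  refine (card_mul_ncard_fixed_eq_sum hp horbit (t := U.lact x) (σ := (x • ·))
    fun _ => rfl).trans ?_
  refine Finset.sum_congr rfl fun h _ => congrArg Set.ncard (Set.ext fun u => ?_)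
  rw [mem_fixedBy, toProd_smul]
  rfl

theorem card_mul_movedCard_tensor_coset [Fintype H] (x : P) :
    (Nat.card H : ℤ) * movedCard x (U.tensor (FinGSet.coset Q H)) =
      ∑ h : H, fixDiff U.toProd.carrier x (h : Q) := by
  have hx := U.card_mul_ncard_fixedBy_tensor_coset H x
  have h1 := U.card_mul_ncard_fixedBy_tensor_coset H (1 : P)
  have hcompl := Set.ncard_add_ncard_compl (fixedBy (U.tensor (FinGSet.coset Q H)).carrier x)
  rw [fixedBy_one_eq_univ, Set.ncard_univ, ← hcompl, mul_add, hx] at h1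
  simp only [fixDiff, Finset.sum_sub_distrib, movedCard]
  rw [eq_sub_iff_add_eq']
  exact_mod_cast h1

end Coset

end FinBiset

end FixedPoints

section CentralSocle

open MulAction Subgroup

/-- `z` is a nontrivial central element, and generates the smallest nontrivial subgroup of `A`.
When `A` is a cyclic `p`-group, this says that `z` generates the socle of `A` and is central. -/
structure IsCentralSocle {R : Type*} [Group R] (A : Subgroup R) (z : R) : Prop where
  mem : z ∈ A
  ne_one : z ≠ 1
  mem_zpowers : ∀ x ∈ A, x ≠ 1 → z ∈ zpowers x
  mem_center : z ∈ center R

theorem mk_one_mem_of_coprime {R R' : Type*} [Group R] [Group R'] {L : Subgroup (R × R')}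
    {x : R} {y : R'} (hc : (orderOf x).Coprime (orderOf y)) (h : (x, y) ∈ L) : (x, 1) ∈ L := by
  obtain ⟨m, hm⟩ := exists_pow_eq_self_of_coprime hc.symm
  simpa [Prod.pow_mk, hm, pow_orderOf_eq_one] using pow_mem (pow_mem h (orderOf y)) m

theorem one_mk_mem_of_coprime {R R' : Type*} [Group R] [Group R'] {L : Subgroup (R × R')}
    {x : R} {y : R'} (hc : (orderOf x).Coprime (orderOf y)) (h : (x, y) ∈ L) : (1, y) ∈ L := by
  simpa using mul_mem (inv_mem (mk_one_mem_of_coprime hc h)) h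

namespace IsCentralSocle

variable {R R' : Type*} [Group R] [Group R'] {A : Subgroup R} {z : R} {A' : Subgroup R'} {z' : R'}

theorem eq_one_of_mem (h : IsCentralSocle A z) {L : Subgroup R} (hz : z ∉ L) {x : R}
    (hx : x ∈ A) (hxL : x ∈ L) : x = 1 := by
  by_contra hne
  exact hz (zpowers_le.2 hxL (h.mem_zpowers x hx hne))

theorem left_eq_one (h : IsCentralSocle A z) {L : Subgroup (R × R')} (hz : (z, 1) ∉ L) {x : R}
    (hx : x ∈ A) (hxL : (x, 1) ∈ L) : x = 1 :=
  h.eq_one_of_mem (L := L.comap (MonoidHom.inl R R')) hz hx hxL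

theorem right_eq_one (h : IsCentralSocle A' z') {L : Subgroup (R × R')} (hz : (1, z') ∉ L) {y : R'}
    (hy : y ∈ A') (hyL : (1, y) ∈ L) : y = 1 :=
  h.eq_one_of_mem (L := L.comap (MonoidHom.inr R R')) hz hy hyL

theorem eq_of_sq_eq_one (h : IsCentralSocle A z) {x : R} (hx : x ∈ A) (hne : x ≠ 1)
    (hsq : x ^ 2 = 1) : x = z := by
  obtain ⟨i, hi⟩ := h.mem_zpowers x hx hne
  rcases Int.even_or_odd' i with ⟨j, rfl | rfl⟩
  · simp [zpow_mul, zpow_ofNat, hsq, h.ne_one.symm] at hi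
  · simpa [zpow_add, zpow_mul, zpow_ofNat, hsq] using hi

theorem prod_inf_eq_bot (h : IsCentralSocle A z) (h' : IsCentralSocle A' z') (hsq : z' ^ 2 = 1)
    {L : Subgroup (R × R')} (hl : (z, 1) ∉ L) (hr : (1, z') ∉ L) (hlr : (z, z') ∉ L) :
    A.prod A' ⊓ L = ⊥ := by
  rw [eq_bot_iff_forall]
  rintro ⟨x, y⟩ hmem
  obtain ⟨⟨hx, hy⟩, hxy⟩ : (x ∈ A ∧ y ∈ A') ∧ (x, y) ∈ L := hmem
  obtain rfl : y = 1 := by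
    by_contra hne
    obtain ⟨j, rfl⟩ := h'.mem_zpowers y hy hne
    have hj : (x ^ j, y ^ j) ∈ L := L.zpow_mem hxy j
    have hj1 : x ^ j ≠ 1 := fun h1 => hr (h1 ▸ hj)
    have hj2 : (x ^ j) ^ 2 = 1 :=
      h.left_eq_one hl (pow_mem (zpow_mem hx j) 2) (hsq ▸ pow_mem hj 2)
    exact hlr (h.eq_of_sq_eq_one (zpow_mem hx j) hj1 hj2 ▸ hj)
  rw [h.left_eq_one hl hx hxy, Prod.mk_one_one]

theorem prod_inf_eq_bot_of_coprime (h : IsCentralSocle A z) (h' : IsCentralSocle A' z')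
    (hc : (Nat.card A).Coprime (Nat.card A')) {L : Subgroup (R × R')} (hl : (z, 1) ∉ L)
    (hr : (1, z') ∉ L) : A.prod A' ⊓ L = ⊥ := by
  rw [eq_bot_iff_forall]
  rintro ⟨x, y⟩ hmem
  obtain ⟨⟨hx, hy⟩, hxy⟩ : (x ∈ A ∧ y ∈ A') ∧ (x, y) ∈ L := hmem
  have hxyc : (orderOf x).Coprime (orderOf y) :=
    hc.of_dvd (A.orderOf_dvd_natCard hx) (A'.orderOf_dvd_natCard hy)
  rw [h.left_eq_one hl hx (mk_one_mem_of_coprime hxyc hxy),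
    h'.right_eq_one hr hy (one_mk_mem_of_coprime hxyc hxy), Prod.mk_one_one]

theorem card_mul_card_dvd_ncard_movedByBoth_of_coprime (h : IsCentralSocle A z)
    (h' : IsCentralSocle A' z') (hc : (Nat.card A).Coprime (Nat.card A')) (Ω : Type*) [Finite Ω]
    [MulAction (R × R') Ω] : Nat.card A * Nat.card A' ∣ (movedByBoth Ω z z').ncard := by
  rw [← Nat.card_prod, ← Nat.card_congr (Subgroup.prodEquiv A A').toEquiv]
  exact card_dvd_ncard_of_inf_stabilizer_eq_bot
    (fun γ _ _ => smul_mem_movedByBoth h.mem_center h'.mem_center γ)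
    fun _ hu => h.prod_inf_eq_bot_of_coprime h' hc hu.1 hu.2

theorem fixDiff_one_sub_fixDiff_of_coprime (h : IsCentralSocle A z) (h' : IsCentralSocle A' z')
    (hc : (Nat.card A).Coprime (Nat.card A')) (Ω : Type*) [Finite Ω] [MulAction (R × R') Ω] :
    fixDiff Ω z (1 : R') - fixDiff Ω z z' = (movedByBoth Ω z z').ncard := by
  have hempty : movedByBoth Ω z z' ∩ fixedBy Ω (z, z') = ∅ :=
    Set.eq_empty_iff_forall_notMem.2 fun u hu =>
      (mem_movedByBoth.1 hu.1).1 <| mk_one_mem_of_coprime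
        (hc.of_dvd (A.orderOf_dvd_natCard h.mem) (A'.orderOf_dvd_natCard h'.mem))
        (mem_stabilizer_iff.2 hu.2)
  rw [fixDiff_one_sub_fixDiff, hempty, Set.ncard_empty, Nat.cast_zero, add_zero]

end IsCentralSocle

section FreeOrbitParity

variable {R : Type} [Group R] {A : Subgroup R} {z : R}

theorem IsCentralSocle.card_dvd_movedCard (h : IsCentralSocle A z) (X : FinGSet R) :
    Nat.card A ∣ movedCard z X :=
  card_dvd_ncard_of_inf_stabilizer_eq_bot
    (fun x _ _ => mt (smul_mem_fixedBy_iff h.mem_center x).1) fun u hu =>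
    (eq_bot_iff_forall _).2 fun _ hx => h.eq_one_of_mem (L := stabilizer R u) hu hx.1 hx.2

/-- The linear form on `𝔽₂B(R)` that maps the class of `X` to the parity of the number of
`A`-orbits of points moved by `z`, on which `A` acts freely. -/
noncomputable def freeOrbitParity (h : IsCentralSocle A z) :
    Burnside (ZMod 2) R →ₗ[ZMod 2] ULift.{1} (ZMod 2) :=
  Burnside.lift (fun X => ⟨((movedCard z X / Nat.card A : ℕ) : ZMod 2)⟩)
    (fun X Y hXY => by rw [movedCard_eq_of_iso z hXY])
    (fun X Y => by
      rw [movedCard_disjUnion, Nat.add_div_of_dvd_right (h.card_dvd_movedCard X), Nat.cast_add]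
      rfl)

theorem freeOrbitParity_cls_sub_eq_zero_iff [Finite A] (h : IsCentralSocle A z) (X Y : FinGSet R) :
    freeOrbitParity h (Burnside.cls _ X - Burnside.cls _ Y) = 0 ↔
      2 * (Nat.card A : ℤ) ∣ movedCard z X - movedCard z Y := by
  obtain ⟨m, hm⟩ := h.card_dvd_movedCard X
  obtain ⟨n, hn⟩ := h.card_dvd_movedCard Y
  have hA : 0 < Nat.card A := Nat.card_pos
  have hdvd : 2 * (Nat.card A : ℤ) ∣ movedCard z X - movedCard z Y ↔
      ((m - n : ℤ) : ZMod 2) = 0 := by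
    rw [hm, hn, Nat.cast_mul, Nat.cast_mul, ← mul_sub, mul_comm,
      mul_dvd_mul_iff_left (by exact_mod_cast hA.ne'), ZMod.intCast_zmod_eq_zero_iff_dvd]
    rfl
  rw [hdvd, map_sub, sub_eq_zero,
    freeOrbitParity, Burnside.lift_cls, Burnside.lift_cls, hm, hn, Nat.mul_div_cancel_left _ hA,
    Nat.mul_div_cancel_left _ hA, ULift.up_inj, Int.cast_sub, sub_eq_zero, Int.cast_natCast,
    Int.cast_natCast]

end FreeOrbitParity

end CentralSocle

section TwoGroups

open MulAction Subgroup

theorem card_dvd_card_inf_mul_index {G : Type*} [Group G] (P L : Subgroup G) [P.Normal] :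
    Nat.card L ∣ Nat.card ↥(P ⊓ L) * P.index := by
  rw [← relIndex_bot_left, ← relIndex_mul_relIndex ⊥ (P ⊓ L) L bot_le inf_le_right,
    relIndex_bot_left, inf_relIndex_right]
  exact mul_dvd_mul_left _ (relIndex_dvd_index_of_normal P L)

theorem mem_zpowers_of_orderOf_eq_two_pow {G : Type*} [Group G] {a : G} {k : ℕ}
    (ha : orderOf a = 2 ^ k) {x : G} (hx : x ∈ zpowers a) (hne : x ≠ 1) :
    a ^ 2 ^ (k - 1) ∈ zpowers x := by
  have hfin : IsOfFinOrder a := orderOf_pos_iff.1 (ha ▸ by positivity)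
  obtain ⟨i, rfl⟩ := hfin.mem_powers_iff_mem_zpowers.2 hx
  obtain ⟨s, u, hu, rfl⟩ := Nat.exists_eq_two_pow_mul_odd (n := i) fun h => hne (by simp [h])
  have hs : s < k := by
    by_contra! hle
    refine hne (orderOf_dvd_iff_pow_eq_one.1 ?_)
    exact ha ▸ (pow_dvd_pow 2 hle).mul_right u
  have hz : (a ^ 2 ^ (k - 1)) ^ 2 = 1 := by
    rw [← pow_mul, ← pow_succ, Nat.sub_add_cancel (by lia), ← ha, pow_orderOf_eq_one]
  have : (a ^ (2 ^ s * u)) ^ 2 ^ (k - 1 - s) = a ^ 2 ^ (k - 1) := by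
    rw [← pow_mul, mul_right_comm, ← pow_add, Nat.add_sub_cancel' (by lia), pow_mul]
    obtain ⟨m, rfl⟩ := hu
    rw [pow_succ, pow_mul, hz, one_pow, one_mul]
  exact this ▸ npow_mem_zpowers _ _

/-- `R` is cyclic of order `4` and generated by `a` (if `k = 2` and `e = 0`), or semidihedral of
order `2 ^ (k + 1)` with cyclic maximal subgroup `⟨a⟩` (if `3 ≤ k` and `e = 1`). -/
structure IsFourOrSemidihedral {R : Type*} [Group R] (k e : ℕ) (a : R) : Prop where
  orderOf_eq : orderOf a = 2 ^ k
  index_eq : (zpowers a).index = 2 ^ e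
  exponents : k = 2 ∧ e = 0 ∨ 3 ≤ k ∧ e = 1
  conj_eq : ∀ g ∉ zpowers a, g * a * g⁻¹ = a⁻¹ * a ^ 2 ^ (k - 1)

namespace IsFourOrSemidihedral

variable {R : Type*} [Group R] {k e : ℕ} {a : R}

theorem card_zpowers_eq (h : IsFourOrSemidihedral k e a) : Nat.card (zpowers a) = 2 ^ k :=
  (Nat.card_zpowers a).trans h.orderOf_eq

theorem card_eq (h : IsFourOrSemidihedral k e a) : Nat.card R = 2 ^ (k + e) := by
  rw [← (zpowers a).card_mul_index, h.card_zpowers_eq, h.index_eq, pow_add]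

theorem pow_two_pow_eq_one (h : IsFourOrSemidihedral k e a) {x : R} (hx : x ∈ zpowers a) {n : ℕ}
    (hn : k ≤ n) : x ^ 2 ^ n = 1 :=
  orderOf_dvd_iff_pow_eq_one.1 <| (orderOf_dvd_of_mem_zpowers hx).trans <|
    h.orderOf_eq ▸ pow_dvd_pow 2 hn

theorem sq_socle_eq_one (h : IsFourOrSemidihedral k e a) : (a ^ 2 ^ (k - 1)) ^ 2 = 1 := by
  have hk : k ≤ k - 1 + 1 := by lia
  rw [← pow_mul, ← pow_succ, h.pow_two_pow_eq_one (mem_zpowers a) hk]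

theorem conj_eq_of_mem (h : IsFourOrSemidihedral k e a) {g x : R} (hg : g ∉ zpowers a)
    (hx : x ∈ zpowers a) : g * x * g⁻¹ = x⁻¹ * x ^ 2 ^ (k - 1) := by
  obtain ⟨i, rfl⟩ := hx
  have hcomm : Commute a⁻¹ (a ^ 2 ^ (k - 1)) := (Commute.refl a).inv_left.pow_right _
  change g * a ^ i * g⁻¹ = (a ^ i)⁻¹ * (a ^ i) ^ 2 ^ (k - 1)
  rw [← conj_zpow, h.conj_eq g hg, hcomm.mul_zpow, inv_zpow, ← zpow_natCast, ← zpow_natCast,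
    zpow_comm]

theorem normal (h : IsFourOrSemidihedral k e a) : (zpowers a).Normal := by
  refine ⟨fun x hx g => ?_⟩
  by_cases hg : g ∈ zpowers a
  · exact mul_mem (mul_mem hg hx) (inv_mem hg)
  · exact h.conj_eq_of_mem hg hx ▸ mul_mem (inv_mem hx) (pow_mem hx _)

theorem exponents_of_notMem (h : IsFourOrSemidihedral k e a) {g : R} (hg : g ∉ zpowers a) :
    3 ≤ k ∧ e = 1 := by
  refine h.exponents.resolve_left fun he => hg ?_
  rw [index_eq_one.1 (h.index_eq.trans (by rw [he.2, pow_zero]))]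
  exact mem_top g

theorem pow_eq_one_of_pow_four_eq_one (h : IsFourOrSemidihedral k e a) {g x : R}
    (hg : g ∉ zpowers a) (hx : x ^ 4 = 1) : x ^ 2 ^ (k - 1) = 1 := by
  have hk := (h.exponents_of_notMem hg).1
  exact orderOf_dvd_iff_pow_eq_one.1 ((orderOf_dvd_of_pow_eq_one hx).trans
    (pow_dvd_pow 2 (by lia : 2 ≤ k - 1)))

theorem sq_eq_one_of_conj_eq_self (h : IsFourOrSemidihedral k e a) {g x : R} (hg : g ∉ zpowers a)
    (hx : x ∈ zpowers a) (hconj : g * x * g⁻¹ = x) : x ^ 2 = 1 := by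
  have hsq : x ^ 2 = x ^ 2 ^ (k - 1) := by
    rw [sq, ← inv_mul_eq_iff_eq_mul.1 ((h.conj_eq_of_mem hg hx).symm.trans hconj)]
  have h4 : x ^ 4 = 1 := by
    rw [show 4 = 2 * 2 by rfl, pow_mul, hsq, ← pow_mul, ← pow_succ,
      h.pow_two_pow_eq_one hx (by lia)]
  rw [hsq, h.pow_eq_one_of_pow_four_eq_one hg h4]

theorem isCentralSocle (h : IsFourOrSemidihedral k e a) :
    IsCentralSocle (zpowers a) (a ^ 2 ^ (k - 1)) where
  mem := npow_mem_zpowers a _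
  ne_one := by
    have := h.exponents
    exact pow_ne_one_of_lt_orderOf (by positivity)
      (h.orderOf_eq ▸ Nat.pow_lt_pow_right one_lt_two (by lia))
  mem_zpowers _ hx hne := mem_zpowers_of_orderOf_eq_two_pow h.orderOf_eq hx hne
  mem_center := by
    refine mem_center_iff.2 fun g => ?_
    by_cases hg : g ∈ zpowers a
    · obtain ⟨i, rfl⟩ := hg
      exact (((Commute.refl a).zpow_left i).pow_right _).eq
    · have hz := h.sq_socle_eq_one
      have h4 : (a ^ 2 ^ (k - 1)) ^ 4 = 1 := by
        rw [show 4 = 2 * 2 by rfl, pow_mul, hz, one_pow]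
      have hconj := h.conj_eq_of_mem hg (npow_mem_zpowers a (2 ^ (k - 1)))
      rw [h.pow_eq_one_of_pow_four_eq_one hg h4, mul_one,
        inv_eq_of_mul_eq_one_left ((sq _).symm.trans hz)] at hconj
      exact mul_inv_eq_iff_eq_mul.1 hconj

theorem center_eq (h : IsFourOrSemidihedral k 1 a) :
    center R = zpowers (a ^ 2 ^ (k - 1)) := by
  have hk : 3 ≤ k := by have := h.exponents; lia
  refine le_antisymm (fun x hx => ?_) (zpowers_le.2 h.isCentralSocle.mem_center)
  have hconj (g : R) : g * x * g⁻¹ = x := by rw [mem_center_iff.1 hx g, mul_inv_cancel_right]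
  have hxa : x ∈ zpowers a := by
    by_contra hxa
    have hsq : a ^ 2 = 1 := h.sq_eq_one_of_conj_eq_self hxa (Subgroup.mem_zpowers a) <| by
      rw [← mem_center_iff.1 hx a, mul_inv_cancel_right]
    refine pow_ne_one_of_lt_orderOf two_ne_zero ?_ hsq
    exact h.orderOf_eq ▸ Nat.pow_lt_pow_right (m := 1) one_lt_two (by lia)
  obtain ⟨g, hg⟩ : ∃ g, g ∉ zpowers a := by
    by_contra! hall
    have hindex := h.index_eq
    rw [(eq_top_iff' _).2 hall, index_top] at hindex
    lia
  rcases eq_or_ne x 1 with rfl | hne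
  · exact one_mem _
  · rw [h.isCentralSocle.eq_of_sq_eq_one hxa hne (h.sq_eq_one_of_conj_eq_self hg hxa (hconj g))]
    exact Subgroup.mem_zpowers _

theorem isConj_mul_socle (h : IsFourOrSemidihedral k e a) {x : R} (hx : x ∉ zpowers a)
    (hsq : x ^ 2 = 1) : IsConj x (x * a ^ 2 ^ (k - 1)) := by
  have hk := (h.exponents_of_notMem hx).1
  have hinv : x⁻¹ = x := inv_eq_of_mul_eq_one_left ((sq x).symm.trans hsq)
  let t := a ^ 2 ^ (k - 2)
  have ht2 : t ^ 2 = a ^ 2 ^ (k - 1) := by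
    rw [← pow_mul, ← pow_succ, show k - 2 + 1 = k - 1 by lia]
  have ht4 : t ^ 4 = 1 := by rw [show 4 = 2 * 2 by rfl, pow_mul, ht2, h.sq_socle_eq_one]
  have hconj : x * t⁻¹ * x⁻¹ = t := by
    have := h.conj_eq_of_mem hx (inv_mem (npow_mem_zpowers a (2 ^ (k - 2))))
    rwa [h.pow_eq_one_of_pow_four_eq_one hx (x := t⁻¹) (by rw [inv_pow, ht4, inv_one]), mul_one,
      inv_inv] at this
  refine isConj_iff.2 ⟨t⁻¹, ?_⟩
  rw [hinv, mul_assoc, ← eq_inv_mul_iff_mul_eq, hinv] at hconj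
  rw [← ht2, inv_inv, sq, ← mul_assoc, hconj]

end IsFourOrSemidihedral

theorem card_dvd_of_isCyclic_of_forall_pow_eq_one {G : Type*} [Group G] (M : Subgroup G)
    [IsCyclic M] {n : ℕ} (h : ∀ q ∈ M, q ^ n = 1) : Nat.card M ∣ n := by
  rw [← IsCyclic.exponent_eq_card]
  exact Monoid.exponent_dvd_of_forall_pow_eq_one fun q => Subtype.ext (h q q.2)

theorem card_dvd_card_prod_inf_mul_index {G G' : Type*} [Group G] [Group G'] {A : Subgroup G}
    {A' : Subgroup G'} [A.Normal] (L : Subgroup (G × G'))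
    (hA : ∀ g g', (g, g') ∈ L → g ∈ A → g' ∈ A') :
    Nat.card L ∣ Nat.card ↥(A.prod A' ⊓ L) * A.index := by
  have hinf : A.prod A' ⊓ L = A.prod ⊤ ⊓ L := by
    ext ⟨g, g'⟩
    simp only [mem_inf, mem_prod, mem_top, and_true, and_congr_left_iff, and_iff_left_iff_imp]
    exact hA g g'
  have := card_dvd_card_inf_mul_index (A.prod (⊤ : Subgroup G')) L
  rwa [index_prod, index_top, mul_one, ← hinf] at this

namespace IsCentralSocle

variable {R R' : Type*} [Group R] [Group R'] {A : Subgroup R} {z : R} {A' : Subgroup R'} {z' : R'}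
  {L : Subgroup (R × R')}

theorem right_unique (h : IsCentralSocle A' z') (hz : (1, z') ∉ L) {x : R} {y₁ y₂ : R'}
    (hy₁ : y₁ ∈ A') (hy₂ : y₂ ∈ A') (h₁ : (x, y₁) ∈ L) (h₂ : (x, y₂) ∈ L) : y₁ = y₂ := by
  refine div_eq_one.1 (h.right_eq_one hz (div_mem hy₁ hy₂) ?_)
  simpa using div_mem h₁ h₂

theorem card_prod_inf_dvd (h : IsCentralSocle A' z') (hz : (1, z') ∉ L) [IsCyclic A] {n : ℕ}
    (hn : ∀ x ∈ A, ∀ y ∈ A', (x, y) ∈ L → x ^ n = 1) : Nat.card ↥(A.prod A' ⊓ L) ∣ n := by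
  have hmem (q : ↥(A.prod A' ⊓ L)) : (q.1.1 ∈ A ∧ q.1.2 ∈ A') ∧ (q.1.1, q.1.2) ∈ L := q.2
  let π : ↥(A.prod A' ⊓ L) →* A :=
    ((MonoidHom.fst R R').comp (A.prod A' ⊓ L).subtype).codRestrict A fun q => (hmem q).1.1
  have hπ : Function.Injective π := (injective_iff_map_eq_one π).2 fun q hq => by
    have h1 : q.1.1 = 1 := congrArg Subtype.val hq
    exact Subtype.ext (Prod.ext h1 (h.right_eq_one hz (hmem q).1.2 (h1 ▸ (hmem q).2)))
  have : IsCyclic ↥(A.prod A' ⊓ L) := isCyclic_of_injective π hπ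
  refine card_dvd_of_isCyclic_of_forall_pow_eq_one _ fun q hq => ?_
  obtain ⟨⟨hx, hy⟩, hL⟩ := hmem ⟨q, hq⟩
  have h1 : q.1 ^ n = 1 := hn _ hx _ hy hL
  exact Prod.ext h1 (h.right_eq_one hz (pow_mem hy n) (h1 ▸ pow_mem hL n))

end IsCentralSocle

namespace IsFourOrSemidihedral

section

variable {R : Type*} [Group R] {k e : ℕ} {a : R}

theorem isConj_mul_socle_of_mem (h : IsFourOrSemidihedral k e a) {H : Subgroup R}
    (hH : Nat.card H = 2 ^ e) (hz : a ^ 2 ^ (k - 1) ∉ H) {x : R} (hx : x ∈ H) (hne : x ≠ 1) :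
    IsConj x (x * a ^ 2 ^ (k - 1)) := by
  have hsq : x ^ 2 = 1 := by
    refine orderOf_dvd_iff_pow_eq_one.1 ((H.orderOf_dvd_natCard hx).trans ?_)
    exact hH ▸ pow_dvd_pow (n := 1) 2 (by have := h.exponents; lia)
  refine h.isConj_mul_socle (fun hxa => hz ?_) hsq
  exact h.isCentralSocle.eq_of_sq_eq_one hxa hne hsq ▸ hx

end

variable {R R' : Type*} [Group R] [Group R'] {k e k' e' : ℕ} {a : R} {a' : R'}
  {L : Subgroup (R × R')}

theorem index_prod_eq (h : IsFourOrSemidihedral k e a) (h' : IsFourOrSemidihedral k' e' a') :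
    ((zpowers a).prod (zpowers a')).index = 2 ^ (e + e') := by
  rw [index_prod, h.index_eq, h'.index_eq, pow_add]

theorem right_mem_of_left_mem (h' : IsFourOrSemidihedral k' e' a')
    (hr : (1, a' ^ 2 ^ (k' - 1)) ∉ L) {x : R} {y : R'} (hx : x ∈ zpowers a) (hy : y ∈ zpowers a')
    (hxy : (x, y) ∈ L) (hsq : y ^ 2 ≠ 1) {g : R} {g' : R'} (hg : (g, g') ∈ L)
    (hga : g ∈ zpowers a) : g' ∈ zpowers a' := by
  by_contra hga'
  have hconj : (x, g' * y * g'⁻¹) ∈ L := by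
    have hcomm : g * x = x * g := by
      obtain ⟨i, rfl⟩ := hga
      obtain ⟨j, rfl⟩ := hx
      exact zpow_mul_comm a i j
    simpa [hcomm] using mul_mem (mul_mem hg hxy) (inv_mem hg)
  exact hsq (h'.sq_eq_one_of_conj_eq_self hga' hy
    (h'.isCentralSocle.right_unique hr (h'.normal.conj_mem y hy g') hy hconj hxy))

theorem left_mem_iff_right_mem (h : IsFourOrSemidihedral k e a)
    (h' : IsFourOrSemidihedral k' e' a') (hl : (a ^ 2 ^ (k - 1), 1) ∉ L)
    (hr : (1, a' ^ 2 ^ (k' - 1)) ∉ L) {x : R} {y : R'} (hx : x ∈ zpowers a) (hy : y ∈ zpowers a')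
    (hxy : (x, y) ∈ L) (hsq : x ^ 2 ≠ 1) {g : R} {g' : R'} (hg : (g, g') ∈ L) :
    g ∈ zpowers a ↔ g' ∈ zpowers a' := by
  have hsq' : y ^ 2 ≠ 1 := fun hy2 =>
    hsq (h.isCentralSocle.left_eq_one hl (pow_mem hx 2) (hy2 ▸ pow_mem hxy 2))
  exact ⟨h'.right_mem_of_left_mem hr hx hy hxy hsq' hg,
    h.right_mem_of_left_mem (L := L.comap (MulEquiv.prodComm (M := R') (N := R)).toMonoidHom)
      hl hy hx hxy hsq hg⟩

/-- Conjugating `(x, y)` by an element of `L` outside of `⟨a⟩ × ⟨a'⟩` and multiplying by `(x, y)`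
gives `(x ^ 2 ^ (k - 1), y ^ 2 ^ (k' - 1))`, whereas a power of `(x, y)` has the same left component
and trivial right component. -/
theorem pow_eq_one_of_notMem (h : IsFourOrSemidihedral k e a) (h' : IsFourOrSemidihedral k' e' a')
    (hk : k' < k) (hl : (a ^ 2 ^ (k - 1), 1) ∉ L) (hr : (1, a' ^ 2 ^ (k' - 1)) ∉ L)
    {g : R} {g' : R'} (hg : (g, g') ∈ L) (hga : g ∉ zpowers a) (hga' : g' ∉ zpowers a') {x : R}
    {y : R'} (hx : x ∈ zpowers a) (hy : y ∈ zpowers a') (hxy : (x, y) ∈ L) :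
    x ^ 2 ^ (k' - 1) = 1 := by
  have hconj : (x ^ 2 ^ (k - 1), y ^ 2 ^ (k' - 1)) ∈ L := by
    have := mul_mem hxy (mul_mem (mul_mem hg hxy) (inv_mem hg))
    simpa [h.conj_eq_of_mem hga hx, h'.conj_eq_of_mem hga' hy] using this
  have hpow : (x ^ 2 ^ (k - 1), 1) ∈ L := by
    have := pow_mem hxy (2 ^ (k - 1))
    rwa [Prod.pow_mk, h'.pow_two_pow_eq_one hy (by lia)] at this
  have hy1 : y ^ 2 ^ (k' - 1) = 1 :=
    h'.isCentralSocle.right_unique hr (pow_mem hy _) (one_mem _) hconj hpow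
  exact h.isCentralSocle.left_eq_one hl (pow_mem hx _) (hy1 ▸ pow_mem hxy _)

theorem card_dvd_of_notMem (h : IsFourOrSemidihedral k e a) (h' : IsFourOrSemidihedral k' e' a')
    (hkk' : k ≠ k') (hl : (a ^ 2 ^ (k - 1), 1) ∉ L) (hr : (1, a' ^ 2 ^ (k' - 1)) ∉ L) :
    Nat.card L ∣ 2 ^ (k' + e - 1) := by
  have := h.normal
  have := h'.normal
  have hexp := h.exponents
  have hexp' := h'.exponents
  set P := (zpowers a).prod (zpowers a')
  have hPn : P.Normal := prod_normal _ _
  have hinf {n : ℕ} : (∀ x ∈ zpowers a, ∀ y ∈ zpowers a', (x, y) ∈ L → x ^ n = 1) →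
      Nat.card ↥(P ⊓ L) ∣ n := h'.isCentralSocle.card_prod_inf_dvd hr
  by_cases hsq : ∀ x ∈ zpowers a, ∀ y ∈ zpowers a', (x, y) ∈ L → x ^ 2 = 1
  · refine (card_dvd_card_inf_mul_index P L).trans ((mul_dvd_mul_right (hinf hsq) _).trans ?_)
    rw [h.index_prod_eq h', ← pow_succ']
    exact pow_dvd_pow 2 (by lia)
  push Not at hsq
  obtain ⟨x₀, hx₀, y₀, hy₀, hxy₀, hsq₀⟩ := hsq
  have hiff {g : R} {g' : R'} (hg : (g, g') ∈ L) : g ∈ zpowers a ↔ g' ∈ zpowers a' :=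
    h.left_mem_iff_right_mem h' hl hr hx₀ hy₀ hxy₀ hsq₀ hg
  have hdvd : Nat.card L ∣ Nat.card ↥(P ⊓ L) * 2 ^ e :=
    h.index_eq ▸ card_dvd_card_prod_inf_mul_index L fun _ _ hg => (hiff hg).1
  have hbound (hdiv : Nat.card ↥(P ⊓ L) ∣ 2 ^ (k' - 1)) : Nat.card L ∣ 2 ^ (k' + e - 1) := by
    refine hdvd.trans ((mul_dvd_mul_right hdiv _).trans ?_)
    rw [← pow_add]
    exact pow_dvd_pow 2 (by lia)
  rcases hkk'.lt_or_gt with hlt | hgt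
  · exact hbound (hinf fun x hx _ _ _ => h.pow_two_pow_eq_one hx (by lia))
  by_cases hLP : L ≤ P
  · rw [← inf_eq_right.2 hLP]
    refine (hinf fun x hx y hy hxy => h.isCentralSocle.left_eq_one hl (pow_mem hx _) ?_).trans
      (pow_dvd_pow 2 (by lia : k' ≤ k' + e - 1))
    exact h'.pow_two_pow_eq_one hy le_rfl ▸ pow_mem hxy _
  · obtain ⟨⟨g, g'⟩, hg, hgP⟩ := SetLike.not_le_iff_exists.1 hLP
    have hga : g ∉ zpowers a := fun hga => hgP ⟨hga, (hiff hg).1 hga⟩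
    exact hbound (hinf fun x hx y hy =>
      h.pow_eq_one_of_notMem h' hgt hl hr hg hga (mt (hiff hg).2 hga) hx hy)

theorem two_pow_dvd_ncard_movedByBoth_sdiff (h : IsFourOrSemidihedral k e a)
    (h' : IsFourOrSemidihedral k' e' a') (Ω : Type*) [Finite Ω] [MulAction (R × R') Ω] :
    2 ^ (k + k') ∣ (movedByBoth Ω (a ^ 2 ^ (k - 1)) (a' ^ 2 ^ (k' - 1)) \
      fixedBy Ω (a ^ 2 ^ (k - 1), a' ^ 2 ^ (k' - 1))).ncard := by
  have hz := h.isCentralSocle.mem_center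
  have hz' := h'.isCentralSocle.mem_center
  rw [pow_add, ← h.card_zpowers_eq, ← h'.card_zpowers_eq, ← Nat.card_prod,
    ← Nat.card_congr (Subgroup.prodEquiv (zpowers a) (zpowers a')).toEquiv]
  refine card_dvd_ncard_of_inf_stabilizer_eq_bot (fun γ _ u hu =>
    ⟨smul_mem_movedByBoth hz hz' γ hu.1,
      mt (smul_mem_fixedBy_iff (mk_mem_center hz hz') γ).1 hu.2⟩) fun u hu => ?_
  exact h.isCentralSocle.prod_inf_eq_bot h'.isCentralSocle h'.sq_socle_eq_one
    hu.1.1 hu.1.2 hu.2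

theorem two_pow_dvd_ncard_movedByBoth (h : IsFourOrSemidihedral k e a)
    (h' : IsFourOrSemidihedral k' e' a') (hkk' : k ≠ k') (Ω : Type*) [Finite Ω]
    [MulAction (R × R') Ω] :
    2 ^ (k + e' + 1) ∣ (movedByBoth Ω (a ^ 2 ^ (k - 1)) (a' ^ 2 ^ (k' - 1)) ∩
      fixedBy Ω (a ^ 2 ^ (k - 1), a' ^ 2 ^ (k' - 1))).ncard := by
  have hz := h.isCentralSocle.mem_center
  have hz' := h'.isCentralSocle.mem_center
  have hexp' := h'.exponents
  refine dvd_ncard_of_dvd_relIndex_stabilizer (A := (⊤ : Subgroup (R × R')))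
    (fun γ _ u hu => Set.mem_inter (smul_mem_movedByBoth hz hz' γ hu.1)
      ((smul_mem_fixedBy_iff (mk_mem_center hz hz') γ).2 hu.2)) fun u hu => ?_
  set L := stabilizer (R × R') u
  rw [relIndex_top_right]
  have hcard : Nat.card L ∣ 2 ^ (k' + e - 1) := h.card_dvd_of_notMem h' hkk' hu.1.1 hu.1.2
  refine Nat.dvd_of_mul_dvd_mul_left (Nat.pos_of_dvd_of_pos hcard (by positivity)) ?_
  rw [L.card_mul_index, Nat.card_prod, h.card_eq, h'.card_eq, ← pow_add]
  refine (mul_dvd_mul_right hcard _).trans ?_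
  rw [← pow_add]
  exact pow_dvd_pow 2 (by lia)

theorem two_pow_dvd_fixDiff (h : IsFourOrSemidihedral k e a)
    (h' : IsFourOrSemidihedral k' e' a') (hkk' : k ≠ k') (Ω : Type*) [Finite Ω]
    [MulAction (R × R') Ω] :
    (2 ^ (k + e' + 2) : ℤ) ∣
      fixDiff Ω (a ^ 2 ^ (k - 1)) (1 : R') - fixDiff Ω (a ^ 2 ^ (k - 1)) (a' ^ 2 ^ (k' - 1)) := by
  have hexp' := h'.exponents
  have hfree := (pow_dvd_pow 2 (by lia : k + e' + 2 ≤ k + k')).trans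
    (h.two_pow_dvd_ncard_movedByBoth_sdiff h' Ω)
  have hfix := mul_dvd_mul_left 2 (h.two_pow_dvd_ncard_movedByBoth h' hkk' Ω)
  rw [← pow_succ'] at hfix
  rw [fixDiff_one_sub_fixDiff, ← Set.ncard_inter_add_ncard_sdiff_eq_ncard
    (movedByBoth Ω (a ^ 2 ^ (k - 1)) (a' ^ 2 ^ (k' - 1)))
    (fixedBy Ω (a ^ 2 ^ (k - 1), a' ^ 2 ^ (k' - 1)))]
  have := dvd_add hfix hfree
  rw [two_mul, add_right_comm (Set.ncard _)] at this
  exact_mod_cast this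

end IsFourOrSemidihedral

end TwoGroups

section Epsilon

open MulAction Subgroup

theorem sum_sup_zpowers {G : Type*} [Group G] {y : G} (hy : y ∈ center G) (hsq : y ^ 2 = 1)
    {H : Subgroup G} (hyH : y ∉ H) [Fintype H] [Fintype ↥(H ⊔ zpowers y)] {M : Type*}
    [AddCommMonoid M] (F : G → M) :
    ∑ x : ↥(H ⊔ zpowers y), F x = ∑ x : H, F x + ∑ x : H, F (x * y) := by
  have : (zpowers y).Normal := ⟨fun x hx g => by
    rwa [mem_center_iff.1 (zpowers_le.2 hy hx) g, mul_inv_cancel_right]⟩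
  let f : H ⊕ H → ↥(H ⊔ zpowers y) := Sum.elim (fun x => ⟨x, mem_sup_left x.2⟩)
    fun x => ⟨x * y, mul_mem_sup x.2 (Subgroup.mem_zpowers y)⟩
  have hinj : f.Injective := by
    refine Function.Injective.sumElim (fun x x' h => ?_) (fun x x' h => ?_) fun x x' h => hyH ?_
    · exact Subtype.ext (Subtype.mk.inj h)
    · exact Subtype.ext (mul_right_cancel (congrArg Subtype.val h))
    · rw [← inv_mul_eq_iff_eq_mul.2 (congrArg Subtype.val h : (x : G) = x' * y)]
      exact mul_mem (inv_mem x'.2) x.2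
  have hsurj : f.Surjective := by
    rintro ⟨x, hx⟩
    obtain ⟨h, hh, _, ⟨i, rfl⟩, rfl⟩ := mem_sup_of_normal_right.1 hx
    rcases Int.even_or_odd' i with ⟨j, rfl | rfl⟩
    · exact ⟨.inl ⟨h, hh⟩, Subtype.ext (by simp [f, zpow_mul, zpow_ofNat, hsq])⟩
    · exact ⟨.inr ⟨h, hh⟩, Subtype.ext (by simp [f, zpow_add, zpow_mul, zpow_ofNat, hsq])⟩
  rw [← (Equiv.ofBijective f ⟨hinj, hsurj⟩).sum_comp, Fintype.sum_sum_type]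
  rfl

theorem movedByBoth_eq_of_zpowers_eq {P Q : Type*} [Group P] [Group Q] (Ω : Type*)
    [MulAction (P × Q) Ω] (x : P) {y y' : Q} (h : zpowers y = zpowers y') :
    movedByBoth Ω x y = movedByBoth Ω x y' := by
  ext u
  have hiff (w : Q) : ((1 : P), w) ∈ stabilizer (P × Q) u ↔
      zpowers w ≤ (stabilizer (P × Q) u).comap (MonoidHom.inr P Q) :=
    (zpowers_le (H := (stabilizer (P × Q) u).comap (MonoidHom.inr P Q))).symm
  rw [mem_movedByBoth, mem_movedByBoth, hiff, hiff, h]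

section Prime

variable {R : Type*} [Group R] (hp : (Nat.card R).Prime) {z : R}
include hp

theorem zpowers_eq_top_of_prime_card (hz : z ≠ 1) : zpowers z = ⊤ := by
  have := Fact.mk hp
  exact (eq_top_iff' _).2 fun _ => mem_zpowers_of_prime_card rfl hz

theorem isCentralSocle_top_of_prime_card (hz : z ≠ 1) : IsCentralSocle ⊤ z where
  mem := mem_top z
  ne_one := hz
  mem_zpowers x _ hx := zpowers_eq_top_of_prime_card hp hx ▸ mem_top z
  mem_center := by
    have := Fact.mk hp
    have : IsCyclic R := isCyclic_of_prime_card rfl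
    let := IsCyclic.commGroup (α := R)
    exact mem_center_iff.2 fun g => mul_comm g z

end Prime

namespace FinBiset

variable {P Q : Type} [Group P] [Group Q] [Finite Q] (U : FinBiset P Q)

theorem movedCard_tensor_coset_bot (x : P) :
    movedCard x (U.tensor (FinGSet.coset Q ⊥)) = fixDiff U.toProd.carrier x (1 : Q) := by
  have := U.card_mul_movedCard_tensor_coset ⊥ x
  rwa [card_bot, Nat.cast_one, one_mul, Fintype.sum_unique] at this

theorem two_mul_card_mul_movedCard_sub {y : Q} (hy : y ∈ center Q) (hsq : y ^ 2 = 1)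
    {H : Subgroup Q} (hyH : y ∉ H) (hconj : ∀ h ∈ H, h ≠ 1 → IsConj h (h * y)) (x : P) :
    2 * (Nat.card H : ℤ) * (movedCard x (U.tensor (FinGSet.coset Q H)) -
        movedCard x (U.tensor (FinGSet.coset Q (H ⊔ zpowers y)))) =
      fixDiff U.toProd.carrier x (1 : Q) - fixDiff U.toProd.carrier x y := by
  have := Fintype.ofFinite H
  have := Fintype.ofFinite ↥(H ⊔ zpowers y)
  have hH := U.card_mul_movedCard_tensor_coset H x
  have hK := U.card_mul_movedCard_tensor_coset (H ⊔ zpowers y) x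
  have hcard : Nat.card ↥(H ⊔ zpowers y) = 2 * Nat.card H := by
    simpa only [Finset.sum_const, Finset.card_univ, Fintype.card_eq_nat_card, smul_eq_mul, mul_one,
      two_mul] using sum_sup_zpowers hy hsq hyH fun _ => (1 : ℕ)
  rw [sum_sup_zpowers hy hsq hyH, hcard, Nat.cast_mul, Nat.cast_two] at hK
  have hdiff : ∑ h : H, fixDiff U.toProd.carrier x (h : Q) -
      ∑ h : H, fixDiff U.toProd.carrier x (h * y) =
      fixDiff U.toProd.carrier x (1 : Q) - fixDiff U.toProd.carrier x y := by
    rw [← Finset.sum_sub_distrib, Fintype.sum_eq_single 1 fun h hne => ?_]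
    · rw [OneMemClass.coe_one, one_mul]
    · exact sub_eq_zero.2 (fixDiff_eq_of_isConj x (hconj h h.2 fun h1 => hne (Subtype.ext h1)))
  linear_combination 2 * hH - hK + hdiff

theorem card_mul_movedCard_sub_of_prime_card (hp : (Nat.card Q).Prime) {A : Subgroup P} {x : P}
    (h : IsCentralSocle A x) (hc : (Nat.card A).Coprime (Nat.card Q)) {y : Q} (hy : y ≠ 1) :
    (Nat.card Q : ℤ) * (movedCard x (U.tensor (FinGSet.coset Q ⊥)) -
        movedCard x (U.tensor (FinGSet.coset Q ⊤))) =
      (Nat.card Q - 1) * (movedByBoth U.toProd.carrier x y).ncard := by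
  classical
  have := Fintype.ofFinite (⊤ : Subgroup Q)
  have hdiff {q : Q} (hq : q ≠ 1) : fixDiff U.toProd.carrier x (1 : Q) -
      fixDiff U.toProd.carrier x q = (movedByBoth U.toProd.carrier x y).ncard := by
    rw [h.fixDiff_one_sub_fixDiff_of_coprime (isCentralSocle_top_of_prime_card hp hq)
      (by rwa [card_top]), movedByBoth_eq_of_zpowers_eq _ x
      ((zpowers_eq_top_of_prime_card hp hq).trans (zpowers_eq_top_of_prime_card hp hy).symm)]
  have hsum : ∑ q : (⊤ : Subgroup Q), (fixDiff U.toProd.carrier x (1 : Q) -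
      fixDiff U.toProd.carrier x (q : Q)) =
      (Nat.card Q - 1) * (movedByBoth U.toProd.carrier x y).ncard := by
    rw [← Finset.add_sum_erase _ _ (Finset.mem_univ 1), OneMemClass.coe_one, sub_self, zero_add,
      Finset.sum_congr rfl fun q hq => hdiff fun h1 =>
        (Finset.mem_erase.1 hq).1 (Subtype.ext h1), Finset.sum_const,
      Finset.card_erase_of_mem (Finset.mem_univ _), Finset.card_univ, Fintype.card_eq_nat_card,
      card_top, nsmul_eq_mul, Nat.cast_sub hp.one_le, Nat.cast_one]
  have htop := U.card_mul_movedCard_tensor_coset ⊤ x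
  rw [Finset.sum_sub_distrib, Finset.sum_const, Finset.card_univ, Fintype.card_eq_nat_card,
    card_top, nsmul_eq_mul, ← htop, card_top, ← movedCard_tensor_coset_bot, ← mul_sub] at hsum
  exact hsum

theorem two_mul_card_dvd_movedCard_sub_of_prime_card (hp : (Nat.card Q).Prime)
    (hodd : Odd (Nat.card Q)) {A : Subgroup P} {x : P} (h : IsCentralSocle A x)
    (hc : (Nat.card A).Coprime (Nat.card Q)) :
    2 * (Nat.card A : ℤ) ∣ movedCard x (U.tensor (FinGSet.coset Q ⊥)) -
      movedCard x (U.tensor (FinGSet.coset Q ⊤)) := by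
  have : Nontrivial Q := Finite.one_lt_card_iff_nontrivial.1 hp.one_lt
  obtain ⟨y, hy⟩ := exists_ne (1 : Q)
  obtain ⟨m, hm⟩ : Nat.card A * Nat.card Q ∣ (movedByBoth U.toProd.carrier x y).ncard := by
    have := h.card_mul_card_dvd_ncard_movedByBoth_of_coprime
      (isCentralSocle_top_of_prime_card hp hy) (by rwa [card_top]) U.toProd.carrier
    rwa [card_top] at this
  obtain ⟨n, hn⟩ := hodd
  refine Int.dvd_of_mul_dvd_mul_left (Nat.cast_ne_zero.2 hp.ne_zero) ⟨n * m, ?_⟩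
  rw [U.card_mul_movedCard_sub_of_prime_card hp h hc hy, hm, hn]
  push_cast
  ring

theorem two_mul_dvd_movedCard_sub_of_isFourOrSemidihedral {k e : ℕ} {a : Q}
    (h : IsFourOrSemidihedral k e a) {H : Subgroup Q} (hH : Nat.card H = 2 ^ e)
    (hzH : a ^ 2 ^ (k - 1) ∉ H) {x : P} {n : ℤ} (hn : 2 ^ (e + 2) * n ∣
      fixDiff U.toProd.carrier x (1 : Q) - fixDiff U.toProd.carrier x (a ^ 2 ^ (k - 1))) :
    2 * n ∣ movedCard x (U.tensor (FinGSet.coset Q H)) -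
      movedCard x (U.tensor (FinGSet.coset Q (H ⊔ zpowers (a ^ 2 ^ (k - 1))))) := by
  rw [← U.two_mul_card_mul_movedCard_sub h.isCentralSocle.mem_center h.sq_socle_eq_one hzH
    (fun _ => h.isConj_mul_socle_of_mem hH hzH), hH] at hn
  refine Int.dvd_of_mul_dvd_mul_left (a := 2 ^ (e + 1)) (by positivity) ?_
  convert hn using 1 <;> push_cast <;> ring

end FinBiset

/-- The subgroups that enter into the definition of `ε_R = R/H - R/H⟨z⟩`, together with a cyclic
subgroup `A` of order `|R : H|` whose socle is `⟨z⟩`. -/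
inductive IsEpsilonData {R : Type} [Group R] : Subgroup R → R → Subgroup R → Prop
  | prime (hp : (Nat.card R).Prime) (hodd : Odd (Nat.card R)) {z : R} (hz : z ≠ 1) :
      IsEpsilonData ⊤ z ⊥
  | twoGroup {k e : ℕ} {a : R} (h : IsFourOrSemidihedral k e a) {H : Subgroup R}
      (hH : Nat.card H = 2 ^ e) (hz : a ^ 2 ^ (k - 1) ∉ H) :
      IsEpsilonData (zpowers a) (a ^ 2 ^ (k - 1)) H

namespace IsEpsilonData

variable {R R' : Type} [Group R] [Group R'] {A H : Subgroup R} {z : R} {A' H' : Subgroup R'}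
  {z' : R'}

theorem isCentralSocle (h : IsEpsilonData A z H) : IsCentralSocle A z := by
  cases h with
  | prime hp hodd hz => exact isCentralSocle_top_of_prime_card hp hz
  | twoGroup h => exact h.isCentralSocle

theorem notMem (h : IsEpsilonData A z H) : z ∉ H := by
  cases h with
  | prime hp hodd hz => exact hz
  | twoGroup h hH hz => exact hz

theorem index_eq (h : IsEpsilonData A z H) : H.index = Nat.card A := by
  cases h with
  | prime => rw [index_bot, card_top]
  | @twoGroup k e a h _ hH =>
    refine Nat.eq_of_mul_eq_mul_left (Nat.two_pow_pos e) ?_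
    rw [← hH, card_mul_index, hH, h.card_zpowers_eq, h.card_eq, pow_add, mul_comm]

theorem two_mul_card_dvd_movedCard_sub [Finite R'] (h : IsEpsilonData A z H)
    (h' : IsEpsilonData A' z' H') (hne : Nat.card R ≠ Nat.card R') (U : FinBiset R R') :
    2 * (Nat.card A : ℤ) ∣ movedCard z (U.tensor (FinGSet.coset R' H')) -
      movedCard z (U.tensor (FinGSet.coset R' (H' ⊔ zpowers z'))) := by
  have hz := h.isCentralSocle
  cases h' with
  | prime hp' hodd' hz' =>
    rw [zpowers_eq_top_of_prime_card hp' hz', sup_top_eq]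
    refine U.two_mul_card_dvd_movedCard_sub_of_prime_card hp' hodd' hz ?_
    cases h with
    | prime hp => rwa [card_top, Nat.coprime_primes hp hp']
    | twoGroup h =>
      rw [h.card_zpowers_eq]
      exact (Nat.coprime_two_left.2 hodd').pow_left _
  | @twoGroup k' e' a' h' _ hH' hzH' =>
    have hexp' := h'.exponents
    refine U.two_mul_dvd_movedCard_sub_of_isFourOrSemidihedral h' hH' hzH' ?_
    cases h with
    | prime hp hodd =>
      have hc : (Nat.card (⊤ : Subgroup R)).Coprime (Nat.card (zpowers a')) := by
        rw [card_top, h'.card_zpowers_eq]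
        exact (Nat.coprime_two_right.2 hodd).pow_right _
      rw [hz.fixDiff_one_sub_fixDiff_of_coprime h'.isCentralSocle hc, mul_comm]
      refine dvd_trans ?_ (Int.natCast_dvd_natCast.2
        (hz.card_mul_card_dvd_ncard_movedByBoth_of_coprime h'.isCentralSocle hc _))
      rw [h'.card_zpowers_eq, Nat.cast_mul, Nat.cast_pow, Nat.cast_two]
      exact mul_dvd_mul_left _ (pow_dvd_pow 2 (by lia))
    | @twoGroup k e a h =>
      have hkk' : k ≠ k' := by
        have hexp := h.exponents
        rintro rfl
        exact hne (by rw [h.card_eq, h'.card_eq, show e = e' by lia])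
      convert h.two_pow_dvd_fixDiff h' hkk' U.toProd.carrier using 1
      rw [h.card_zpowers_eq]
      push_cast
      ring

end IsEpsilonData

theorem isFourOrSemidihedral_of_isCyclic {R : Type*} [Group R] (h4 : Nat.card R = 4) {a : R}
    (ha : ∀ x, x ∈ zpowers a) : IsFourOrSemidihedral 2 0 a where
  orderOf_eq := (orderOf_eq_card_of_forall_mem_zpowers ha).trans h4
  index_eq := by rw [(eq_top_iff' _).2 ha, index_top, pow_zero]
  exponents := .inl ⟨rfl, rfl⟩
  conj_eq g hg := absurd (ha g) hg

theorem IsSemidihedral.exists_isFourOrSemidihedral {R : Type} [Group R] {n : ℕ} (hn : 4 ≤ n)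
    (h : IsSemidihedral n R) :
    ∃ a b : R, IsFourOrSemidihedral (n - 1) 1 a ∧ orderOf b = 2 ∧ b ∉ zpowers a := by
  obtain ⟨hcard, a, b, ha, hb, hba, hgen⟩ := h
  have hindex : (zpowers a).index = 2 := by
    refine Nat.eq_of_mul_eq_mul_left (Nat.two_pow_pos (n - 1)) ?_
    rw [← ha, ← Nat.card_zpowers, card_mul_index, Nat.card_zpowers, ha, hcard, ← pow_succ,
      Nat.sub_add_cancel (by lia)]
  have hbmem : b ∉ zpowers a := fun hb => by
    have htop : zpowers a = ⊤ := top_le_iff.1 <| hgen ▸ (closure_le _).2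
      (Set.pair_subset_iff.2 ⟨Subgroup.mem_zpowers a, hb⟩)
    rw [htop, index_top] at hindex
    lia
  have hconj : b * a * b⁻¹ = a⁻¹ * a ^ 2 ^ (n - 1 - 1) := by
    rw [hba, eq_inv_mul_iff_mul_eq, ← pow_succ', Nat.sub_add_cancel Nat.one_le_two_pow,
      Nat.sub_sub]
  refine ⟨a, b, ⟨ha, hindex, .inr ⟨by lia, rfl⟩, fun g hg => ?_⟩, hb, hbmem⟩
  have hc : b⁻¹ * g ∈ zpowers a := by
    simp only [mul_mem_iff_of_index_two hindex, inv_mem_iff, hbmem, hg]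
  obtain ⟨i, hi⟩ := hc
  obtain rfl : b * a ^ i = g := mul_eq_of_eq_inv_mul hi
  rw [← hconj]
  group

theorem IsFourOrSemidihedral.zpowers_socle_eq_of_mem {R : Type*} [Group R] {k e : ℕ} {a : R}
    (h : IsFourOrSemidihedral k e a) {T : Subgroup R} (hT : Nat.card T = 2)
    (hz : a ^ 2 ^ (k - 1) ∈ T) : zpowers (a ^ 2 ^ (k - 1)) = T := by
  have : Finite T := Nat.finite_of_card_ne_zero (by lia)
  refine eq_of_le_of_card_ge (zpowers_le.2 hz) ?_
  rw [hT, Nat.card_zpowers, orderOf_eq_prime h.sq_socle_eq_one h.isCentralSocle.ne_one]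

theorem IsEpsilon.exists_isEpsilonData {k R : Type} [CommRing k] [Group R] [Finite R]
    {v : Burnside k R} (hv : IsEpsilon k R v) : ∃ A z H, IsEpsilonData A z H ∧
      v = Burnside.cls k (FinGSet.coset R H) -
        Burnside.cls k (FinGSet.coset R (H ⊔ zpowers z)) := by
  cases hv with
  | prime hp hodd =>
    have : Nontrivial R := Finite.one_lt_card_iff_nontrivial.1 hp.one_lt
    obtain ⟨z, hz⟩ := exists_ne (1 : R)
    refine ⟨⊤, z, ⊥, .prime hp hodd hz, ?_⟩
    rw [zpowers_eq_top_of_prime_card hp hz, sup_top_eq]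
  | four hc h4 T hT =>
    obtain ⟨a, ha⟩ := hc.exists_generator
    have h := isFourOrSemidihedral_of_isCyclic h4 ha
    have : Nontrivial T := Finite.one_lt_card_iff_nontrivial.1 (hT ▸ one_lt_two)
    obtain ⟨⟨x, hxT⟩, hx⟩ := exists_ne (1 : T)
    have hz : a ^ 2 ^ (2 - 1) ∈ T := zpowers_le.2 hxT
      (h.isCentralSocle.mem_zpowers x (ha x) fun h1 => hx (Subtype.ext h1))
    refine ⟨_, _, ⊥, .twoGroup h (by rw [card_bot, pow_zero]) h.isCentralSocle.ne_one, ?_⟩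
    rw [h.zpowers_socle_eq_of_mem hT hz, bot_sup_eq]
  | semidihedral n hn hR I hI hIZ =>
    obtain ⟨a, -, h, -, -⟩ := hR.exists_isFourOrSemidihedral hn
    refine ⟨_, _, I, .twoGroup h hI fun hz => hIZ ?_, by rw [h.center_eq]⟩
    rw [h.center_eq, h.zpowers_socle_eq_of_mem hI hz]

theorem IsEpsilonData.freeOrbitParity_ne_zero {R : Type} [Group R] [Finite R] {A H : Subgroup R}
    {z : R} (h : IsEpsilonData A z H) :
    freeOrbitParity h.isCentralSocle (Burnside.cls _ (FinGSet.coset R H) -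
      Burnside.cls _ (FinGSet.coset R (H ⊔ zpowers z))) ≠ 0 := by
  have hz := h.isCentralSocle.mem_center
  rw [Ne, freeOrbitParity_cls_sub_eq_zero_iff, movedCard_coset_of_notMem hz h.notMem,
    movedCard_coset_of_mem hz (mem_sup_right (Subgroup.mem_zpowers z)), h.index_eq,
    Nat.cast_zero, sub_zero]
  norm_cast
  exact fun hdvd => absurd (Nat.le_of_dvd Nat.card_pos hdvd) (by have := Nat.card_pos (α := A); lia)

theorem IsEpsilonData.mem_maximalWithin_ker {R : Type} {R' : FiniteGrp.{0}} [Group R] [Finite R]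
    {A H : Subgroup R} {z : R} (h : IsEpsilonData A z H)
    (hne : Nat.card R ≠ Nat.card R') {v : Burnside (ZMod 2) R'} (hv : IsEpsilon (ZMod 2) R' v) :
    v ∈ (BurnsideSubfunctor.maximalWithin (LinearMap.ker (freeOrbitParity h.isCentralSocle))).obj
      R' := by
  obtain ⟨A', z', H', h', rfl⟩ := hv.exists_isEpsilonData
  refine BurnsideSubfunctor.mem_maximalWithin.2 fun U => ?_
  rw [LinearMap.mem_ker, map_sub, bisetMap_cls, bisetMap_cls, freeOrbitParity_cls_sub_eq_zero_iff]
  exact h.two_mul_card_dvd_movedCard_sub h' hne U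

end Epsilon

section Family

open Subgroup

theorem isEpsilon_epsilon {k R : Type} [CommRing k] [Group R] [Finite R]
    (h : ∃ v, IsEpsilon k R v) : IsEpsilon k R (epsilon k R) := by
  rw [epsilon, dif_pos h]
  exact h.choose_spec

variable {S : Set FiniteGrp.{0}}

theorem epsilon_notMem_generated_sdiff (hε : ∀ R ∈ S, ∃ v, IsEpsilon (ZMod 2) R v)
    (hcard : S.InjOn fun R : FiniteGrp.{0} => Nat.card R) {R : FiniteGrp.{0}} (hR : R ∈ S) :
    epsilon (ZMod 2) R ∉
      (BurnsideSubfunctor.generated (generators S \ {⟨R, epsilon (ZMod 2) R⟩})).obj R := by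
  obtain ⟨A, z, H, h, hv⟩ := (isEpsilon_epsilon (hε R hR)).exists_isEpsilonData
  intro hmem
  refine h.freeOrbitParity_ne_zero (hv ▸ LinearMap.mem_ker.1
    (BurnsideSubfunctor.maximalWithin_obj_le (R := R) _
      (BurnsideSubfunctor.generated_le ?_ R hmem)))
  rintro _ ⟨⟨R', hR', rfl⟩, hne⟩
  refine h.mem_maximalWithin_ker (fun hRR' => hne ?_) (isEpsilon_epsilon (hε R' hR'))
  obtain rfl : R = R' := hcard hR hR' hRR'
  rfl

theorem generators_ssubset {S' : Set FiniteGrp.{0}} (h : S' ⊂ S) :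
    generators S' ⊂ generators S := by
  obtain ⟨R, hR, hR'⟩ := Set.exists_of_ssubset h
  refine Set.ssubset_iff_exists.2 ⟨?_, ⟨R, _⟩, ⟨R, hR, rfl⟩, ?_⟩
  · rintro _ ⟨R, hR, rfl⟩
    exact ⟨R, h.subset hR, rfl⟩
  · rintro ⟨R₁, hR₁, heq⟩
    obtain rfl : R = R₁ := congrArg Sigma.fst heq
    exact hR' hR₁

theorem exists_isEpsilon_of_isSemidihedral (k : Type) [CommRing k] {R : Type} [Group R] [Finite R]
    {n : ℕ} (hn : 4 ≤ n) (h : IsSemidihedral n R) : ∃ v, IsEpsilon k R v := by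
  obtain ⟨a, b, ha, hb, hba⟩ := h.exists_isFourOrSemidihedral hn
  refine ⟨_, .semidihedral n hn h (zpowers b) (by rw [Nat.card_zpowers, hb]) fun hle => hba ?_⟩
  exact zpowers_le.2 (npow_mem_zpowers a _) (ha.center_eq ▸ hle (Subgroup.mem_zpowers b))

theorem IsFamilyS.exists_isEpsilon (hS : IsFamilyS S) {R : FiniteGrp.{0}} (hR : R ∈ S) :
    ∃ v, IsEpsilon (ZMod 2) R v := by
  rcases hS.mem_type R hR with ⟨hp, hodd⟩ | ⟨hc, h4⟩ | ⟨n, hn, hsd⟩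
  · exact ⟨_, .prime hp hodd⟩
  · obtain ⟨a, ha⟩ := hc.exists_generator
    have h := isFourOrSemidihedral_of_isCyclic h4 ha
    refine ⟨_, .four hc h4 (zpowers (a ^ 2 ^ (2 - 1))) ?_⟩
    rw [Nat.card_zpowers, orderOf_eq_prime h.sq_socle_eq_one h.isCentralSocle.ne_one]
  · exact exists_isEpsilon_of_isSemidihedral _ hn hsd

theorem IsFamilyS.injOn_card (hS : IsFamilyS S) : S.InjOn fun R : FiniteGrp.{0} => Nat.card R := by
  intro R hR R' hR' (h : Nat.card R = Nat.card R')
  have hpow {n : ℕ} (hn : 2 ≤ n) : ¬ (2 ^ n : ℕ).Prime := Nat.Prime.not_prime_pow hn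
  have hpow4 {n : ℕ} (hn : 4 ≤ n) : 2 ^ n ≠ 4 :=
    ((by norm_num : 4 < 2 ^ 4).trans_le (Nat.pow_le_pow_right two_pos hn)).ne'
  have h4 : ¬ Nat.Prime 4 := by norm_num
  rcases hS.mem_type R hR with ⟨hp, hodd⟩ | ⟨hc, hc4⟩ | ⟨n, hn, hsd⟩ <;>
    rcases hS.mem_type R' hR' with ⟨hp', -⟩ | ⟨hc', hc4'⟩ | ⟨m, hm, hsd'⟩
  · exact (hS.prime _ hp hodd).unique ⟨hR, rfl⟩ ⟨hR', h.symm⟩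
  · exact absurd (hc4' ▸ h ▸ hp) h4
  · exact absurd (hsd'.1 ▸ h ▸ hp) (hpow (by lia))
  · exact absurd (hc4 ▸ h ▸ hp') h4
  · exact hS.four.unique ⟨hR, hc, hc4⟩ ⟨hR', hc', hc4'⟩
  · exact absurd (hsd'.1.symm.trans (h.symm.trans hc4)) (hpow4 hm)
  · exact absurd (hsd.1 ▸ h ▸ hp') (hpow (by lia))
  · exact absurd (hsd.1.symm.trans (h.trans hc4')) (hpow4 hn)
  · obtain rfl : n = m := Nat.pow_right_injective le_rfl (hsd.1.symm.trans (h.trans hsd'.1))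
    exact (hS.semidihedral n hn).unique ⟨hR, hsd⟩ ⟨hR', hsd'⟩

end Family

end BisetTheory

open BisetTheory in
theorem theorem6p5_general {S : Set FiniteGrp.{0}}
    (hε : ∀ R ∈ S, ∃ v, IsEpsilon (ZMod 2) R v)
    (hcard : S.InjOn fun R : FiniteGrp.{0} => Nat.card R) :
    BurnsideSubfunctor.IsMinimalGeneratingSet (generators S) (subfunctorL S) ∧
    ∀ S' : Set FiniteGrp.{0}, S' ⊂ S →
      BurnsideSubfunctor.generated (generators S') < subfunctorL S := by
  have hlt {𝒢 : Set (BurnsideSubfunctor.Element (ZMod 2))} (h : 𝒢 ⊂ generators S) :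
      BurnsideSubfunctor.generated 𝒢 < subfunctorL S := by
    refine BurnsideSubfunctor.generated_lt_of_ssubset ?_ h
    rintro _ ⟨R, hR, rfl⟩
    exact epsilon_notMem_generated_sdiff hε hcard hR
  exact ⟨⟨rfl, fun _ h => (hlt h).ne⟩, fun _ h => hlt (generators_ssubset h)⟩

theorem theorem6p5 (S : Set FiniteGrp.{0}) (hS : BisetTheory.IsFamilyS S) :
    BisetTheory.BurnsideSubfunctor.IsMinimalGeneratingSet
      (BisetTheory.generators S) (BisetTheory.subfunctorL S) ∧
    ∀ S' : Set FiniteGrp.{0}, S' ⊂ S →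
      BisetTheory.BurnsideSubfunctor.generated (BisetTheory.generators S') <
        BisetTheory.subfunctorL S :=
  theorem6p5_general (fun _ => hS.exists_isEpsilon) hS.injOn_card
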